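/- **Theorem (Abstract Reconstruction Theorem).** For $n\ge 1$ and $i_1,\dots,i_{n-1},r,d_1,\dots,d_n\in\mathbb Z_{\ge 0}$ consider the formal symbol $$\langle \tau_{d_1}H^{i_1},\dots,\tau_{d_{n-1}}H^{i_{n-1}},\tau_{d_n}H_r\rangle ,$$ whose *degree* is the integer $\sum d_s+\sum i_s-r+(3-n)$. Write $H^i,H_j$ for $\tau_0H^i,\tau_0H_j$, and $H=H^1$. Let $F$ be the set of all symbols of non-negative degree; an expression with a negative $d_s$, a negative subscript $r$ or a negative degree is read as $0$. The *minimal Gromov–Witten ring* is the $\mathbb C$-algebra $GW=\mathbb C[F]/\mathrm{Rel}$, where $\mathbb C[F]$ is the polynomial ring on $F$ and $\mathrm{Rel}$ is the ideal generated by the following relations. * **GW1** ($S_n$-covariance). A symbol does not change when the entries $\tau_{d_1}H^{i_1},\dots,\tau_{d_{n-1}}H^{i_{n-1}}$ are permuted. * **GW2** (normalization). If the degree is $0$, i.e. $r=\sum d_s+\sum i_s+(3-n)$, then $$\langle \tau_{d_1}H^{i_1},\dots,\tau_{d_n}H_r\rangle=\frac{(d_1+\dots+d_n)!}{d_1!\cdots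 d_n!}\,M,$$ with $M=1$ if $\sum d_s=n-3$ and $M=0$ otherwise. * **GW3** (string equation). For $n\ge1$, $$\langle H^0,\tau_{d_1}H^{i_1},\dots,\tau_{d_n}H_r\rangle=\sum_{s=1}^{n-1}\langle \tau_{d_1}H^{i_1},\dots,\tau_{d_s-1}H^{i_s},\dots,\tau_{d_n}H_r\rangle+\langle\tau_{d_1}H^{i_1},\dots,\tau_{d_{n-1}}H^{i_{n-1}},\tau_{d_n-1}H_r\rangle,$$ except when the left side is $\langle H^0,H^i,H_i\rangle$. * **GW4** (divisor axiom). For $n\ge1$, if the left side has degree $d>0$, $$\langle H^1,\tau_{d_1}H^{i_1},\dots,\tau_{d_n}H_r\rangle=d\,\langle \tau_{d_1}H^{i_1},\dots,\tau_{d_n}H_r\rangle+\sum_{s=1}^{n-1}\langle \tau_{d_1}H^{i_1},\dots,\tau_{d_s-1}H^{i_s+1},\dots,\tau_{d_n}H_r\rangle+\langle\tau_{d_1}H^{i_1},\dots,\tau_{d_{n-1}}H^{i_{n-1}},\tau_{d_n-1}H_{r-1}\rangle .$$ * **GW5** (topological recursion). Let $n\ge 0$, let $\tau_{c_1}H^{i_1},\dots,\tau_{c_n}H^{i_n}$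 be given, and for $S\subseteq\{1,\dots,n\}$ let $\coprod_S$ denote the sequence of the entries with index in $S$. If $d_1>0$, then $$\Big\langle\coprod_{\{1,\dots,n\}},\tau_{d_1}H^{j_1},\tau_{d_2}H^{j_2},\tau_{d_3}H_r\Big\rangle=\sum\Big\langle\tau_{d_1-1}H^{j_1},\coprod_{S_1},H_a\Big\rangle\Big\langle H^a,\coprod_{S_2},\tau_{d_2}H^{j_2},\tau_{d_3}H_r\Big\rangle ,$$ and if $d_3>0$, then $$\Big\langle\coprod_{\{1,\dots,n\}},\tau_{d_1}H^{j_1},\tau_{d_2}H^{j_2},\tau_{d_3}H_r\Big\rangle=\sum\Big\langle\coprod_{S_1},\tau_{d_1}H^{j_1},\tau_{d_2}H^{j_2},H_a\Big\rangle\Big\langle H^a,\coprod_{S_2},\tau_{d_3-1}H_r\Big\rangle ,$$ where the sums run over all splittings $S_1\sqcup S_2=\{1,\dots,n\}$ and all integers $a\ge0$ for which both symbols have non-negative degree (finitely many). Let $\mathbb C[a_{ij}]$ be the polynomial ring in the variables $a_{ij}$ with $0\le i\le j$ and $j>0$. Then the homomorphism of $\mathbb C$-algebras $$r\colon \mathbb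 C[a_{ij}]\to GW,\qquad a_{ij}\mapsto\langle H,H^j,H_i\rangle,$$ is an isomorphism. -/

import Mathlib

namespace MinimalGW

open MvPolynomial

/-- The formal symbol `⟨τ_{d₁}H^{i₁}, …, τ_{d_{n-1}}H^{i_{n-1}}, τ_{d_n}H_r⟩`, `n ≥ 1`.
The pair `(d, i)` in the list `up` stands for `τ_d H^i`; the pair `low = (d, r)` stands for
the last entry `τ_d H_r`. So `n = up.length + 1`. -/
@[ext]
structure Symb where
  up : List (ℕ × ℕ)
  low : ℕ × ℕ

/-- The degree `∑ d_s + ∑ i_s - r + (3 - n)` of a symbol. -/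
def Symb.degree (s : Symb) : ℤ :=
  ((s.up.map fun p => (p.1 : ℤ)).sum + s.low.1) + (s.up.map fun p => (p.2 : ℤ)).sum - s.low.2
    + (3 - ((s.up.length : ℤ) + 1))

/-- The set `F` of all symbols of non-negative degree. -/
abbrev F : Type := {s : Symb // 0 ≤ s.degree}

noncomputable section

/-- The symbol with upper entries `u` and last entry `l` as an element of `ℂ[F]`;
symbols of negative degree are read as `0`. -/
def sym (u : List (ℕ × ℕ)) (l : ℕ × ℕ) : MvPolynomial F ℂ :=
  if h : 0 ≤ (Symb.mk u l).degree then X ⟨⟨u, l⟩, h⟩ else 0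

/-- The number on the right-hand side of the normalization axiom: the multinomial coefficient
`(d₁ + ⋯ + d_n)! / (d₁! ⋯ d_n!)` if `∑ d_s = n - 3`, and `0` otherwise. -/
def normValue (u : List (ℕ × ℕ)) (l : ℕ × ℕ) : ℂ :=
  if (u.map Prod.fst).sum + l.1 + 3 = u.length + 1 then
    (((u.map Prod.fst).sum + l.1).factorial : ℂ) /
      ((u.map fun p => (p.1.factorial : ℂ)).prod * (l.1.factorial : ℂ))
  else 0

/-- `∑_s ⟨…, τ_{d_s-1}H^{i_s+k}, …, τ_{d_n}H_r⟩`, summed over the upper entries;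
the summands with `d_s = 0` are `0`. -/
def lowerUp (k : ℕ) (u : List (ℕ × ℕ)) (l : ℕ × ℕ) : MvPolynomial F ℂ :=
  ∑ s : Fin u.length,
    if (u.get s).1 = 0 then 0 else sym (u.set s ((u.get s).1 - 1, (u.get s).2 + k)) l

/-- `⟨…, τ_{d_n-1}H_{r-k}⟩`, which is `0` if `d_n = 0` or `r < k`. -/
def lowerLow (k : ℕ) (u : List (ℕ × ℕ)) (l : ℕ × ℕ) : MvPolynomial F ℂ :=
  if l.1 = 0 ∨ l.2 < k then 0 else sym u (l.1 - 1, l.2 - k)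

/-- The subsequence of `u` (in the order of `u`) of the entries with positions in `S`. -/
def sub (u : List (ℕ × ℕ)) (S : Finset (Fin u.length)) : List (ℕ × ℕ) :=
  ((List.finRange u.length).filter (fun k => decide (k ∈ S))).map u.get

/-- `∑_a ⟨v, H_a⟩ ⟨H^a, w, l⟩` over all `a ≥ 0` for which both symbols have non-negative degree.
The first symbol has degree `deg ⟨v, H_0⟩ - a`, so `a ≤ deg ⟨v, H_0⟩` for these `a`;
see `glue_eq_sum_range`. -/
def glue (v w : List (ℕ × ℕ)) (l : ℕ × ℕ) : MvPolynomial F ℂ :=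
  ∑ a ∈ Finset.range ((Symb.mk v (0, 0)).degree.toNat + 1),
    sym v (0, a) * sym ((0, a) :: w) l

/-- The range of summation in `glue` may be enlarged arbitrarily. -/
theorem glue_eq_sum_range (v w : List (ℕ × ℕ)) (l : ℕ × ℕ) (N : ℕ)
    (hN : (Symb.mk v (0, 0)).degree.toNat + 1 ≤ N) :
    glue v w l = ∑ a ∈ Finset.range N, sym v (0, a) * sym ((0, a) :: w) l := by
  unfold glue
  apply Finset.sum_subset
  · intro a ha
    simp only [Finset.mem_range] at *
    omega
  · intro a _ ha
    have h : ¬ 0 ≤ (Symb.mk v (0, a)).degree := by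
      simp only [Finset.mem_range, Symb.degree] at *
      push_cast at *
      omega
    rw [sym, dif_neg h, zero_mul]

/-- The defining relations `p = q` of the minimal Gromov-Witten ring. -/
inductive Relation : MvPolynomial F ℂ → MvPolynomial F ℂ → Prop
  /-- `S_n`-covariance -/
  | covariance (u v : List (ℕ × ℕ)) (l : ℕ × ℕ) (h : u.Perm v) :
      Relation (sym u l) (sym v l)
  /-- normalization -/
  | normalization (u : List (ℕ × ℕ)) (l : ℕ × ℕ) (h : (Symb.mk u l).degree = 0) :
      Relation (sym u l) (C (normValue u l))
  /-- string equation, except for `⟨H^0, H^i, H_i⟩` -/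
  | string (u : List (ℕ × ℕ)) (l : ℕ × ℕ) (h : ¬ ∃ i : ℕ, u = [(0, i)] ∧ l = (0, i)) :
      Relation (sym ((0, 0) :: u) l) (lowerUp 0 u l + lowerLow 0 u l)
  /-- divisor axiom -/
  | divisor (u : List (ℕ × ℕ)) (l : ℕ × ℕ) (h : 0 < (Symb.mk ((0, 1) :: u) l).degree) :
      Relation (sym ((0, 1) :: u) l)
        (C ((Symb.mk ((0, 1) :: u) l).degree : ℂ) * sym u l + lowerUp 1 u l + lowerLow 1 u l)
  /-- topological recursion at an upper entry `τ_{d+1} H^j` -/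
  | recursionUp (u : List (ℕ × ℕ)) (d j : ℕ) (p l : ℕ × ℕ) :
      Relation (sym (u ++ [(d + 1, j), p]) l)
        (∑ S : Finset (Fin u.length), glue ((d, j) :: sub u S) (sub u Sᶜ ++ [p]) l)
  /-- topological recursion at the last entry `τ_{d+1} H_r` -/
  | recursionLow (u : List (ℕ × ℕ)) (p q : ℕ × ℕ) (d r : ℕ) :
      Relation (sym (u ++ [p, q]) (d + 1, r))
        (∑ S : Finset (Fin u.length), glue (sub u S ++ [p, q]) (sub u Sᶜ) (d, r))

/-- The ideal of relations. -/
def Rel : Ideal (MvPolynomial F ℂ) :=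
  Ideal.span {x | ∃ p q, Relation p q ∧ x = p - q}

/-- The minimal Gromov-Witten ring. -/
abbrev GW : Type := MvPolynomial F ℂ ⧸ Rel

/-- The index set of the variables `a_{ij}`: pairs with `0 ≤ i ≤ j` and `j > 0`. -/
abbrev Idx : Type := {p : ℕ × ℕ // p.1 ≤ p.2 ∧ 0 < p.2}

/-- The prime two-pointed invariant `⟨H, H^j, H_i⟩`, a symbol of degree `j - i + 1`. -/
def prime (p : Idx) : F :=
  ⟨⟨[(0, 1), (0, p.1.2)], (0, p.1.1)⟩, by
    have := p.2.1
    simp [Symb.degree]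
    omega⟩

/-- The map `r : ℂ[a_{ij}] → GW`, `a_{ij} ↦ ⟨H, H^j, H_i⟩`. -/
def r : MvPolynomial Idx ℂ →ₐ[ℂ] GW :=
  aeval fun p => Ideal.Quotient.mkₐ ℂ Rel (X (prime p))

end

end MinimalGW

/-!
The map `r` is injective because it has a left inverse, and surjective because every invariant can
be reconstructed from the two-pointed ones.

*Injectivity.* A left inverse of `r` is a theory of invariants with values in `ℂ[a_ij]` that
satisfies all relations and whose value at `⟨H, H^j, H_i⟩` is `a_ij`. It is built in the manner of
Givental. Let `q` be the parameter of the divisor equation and let `D` act as `H + z q ∂_q`. The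
matrix `a_ij` prescribes the small quantum product with `H`, and the differential equation of this
product has a formal solution `J = 1 + O(z⁻²)` (`MinimalGW.fundSol`, `MinimalGW.JFun.ofMul`). The
descendant potential is encoded by a family of points `f = z exp(g/z) J` with a symbol `g(D, z)`
polynomial in `z`, depending on variables `t_{d,i}` dual to `τ_d H^i`. The requirement that the
part of `f` polynomial in `z` be `z + ∑ t_{d,i} H^i (-z)^d` determines `g`
(`MinimalGW.JFun.exists_isSolution`), since polynomial symbols correspond bijectively to the
polynomial parts of their action on `J` (`MinimalGW.JFun.exists_co_eq`,
`MinimalGW.JFun.eq_zero_of_co`). The invariants are the coefficients of negative powers of `z` in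
`f`. All relations follow from the uniqueness: if `P` is polynomial in `z` and `exp(g/z) P J` has
no polynomial part, then `exp(g/z) P J = 0` (`MinimalGW.JFun.E_mul_eq_zero`). The first and second
derivatives of `f` in the variables `t` are of the form `exp(g/z) P J` up to a factor `z`, which
gives topological recursion; the vector fields `τ_d H^i ↦ τ_{d-1} H^{i+k}` give the string and the
divisor equation, for `k = 0` and `k = 1`, together with the homogeneity of `f`. The top degree
part of this structure, in which `D` acts as `H`, gives the normalization. All power series in `t`
are Hurwitz series, that is, families of iterated derivatives at the origin indexed by multisets
of variables.

*Surjectivity.* Topological recursion lowers the number `∑ d_s` of descendants, if there are at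
least three entries; otherwise entries `H` can be added by the divisor equation
(`MinimalGW.gw_mem_of_contains`). For invariants without descendants, comparing the recursions for
`⟨H, H^{i-1}, H^j, R, τ_1 H_r⟩` at two pairs of entries gives the associativity equations
(`MinimalGW.assocSum_rotate`). Modulo invariants of lower degree they trade `⟨H^i, H^j, R, H_r⟩`
for `⟨H^{i-1+j}, H, R, H_r⟩`, `⟨H, H^j, R, H_a⟩` and `⟨H^{i-1}, H^j, R, H_a⟩`. The first two have
fewer entries by the divisor equation, so induction on degree, number of entries and `i` leads to
`⟨H, H^j, H_i⟩` (`MinimalGW.contains_of_prime`).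
-/

/-! ### Hurwitz series -/

/-- Hurwitz series (exponential formal power series) in commuting variables indexed by `ι`: a
series is recorded by its iterated partial derivatives at the origin, one for each multiset of
variables. -/
structure Hurwitz (ι K : Type*) where
  /-- The iterated partial derivative at the origin. -/
  coeff : Multiset ι → K

namespace Hurwitz

instance (ι K : Type*) : CoeFun (Hurwitz ι K) fun _ => Multiset ι → K := ⟨coeff⟩

@[ext] theorem ext {ι K : Type*} {f g : Hurwitz ι K} (h : ∀ L, f L = g L) : f = g := by
  cases f; cases g; congr; exact funext h

/-- The partial derivative in the direction of the variable `v`. -/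
def der {ι K : Type*} (v : ι) (f : Hurwitz ι K) : Hurwitz ι K := ⟨fun L => f (v ::ₘ L)⟩

@[simp] theorem der_apply {ι K : Type*} (v : ι) (f : Hurwitz ι K) (L) :
    der v f L = f (v ::ₘ L) := rfl

theorem der_comm {ι K : Type*} (v w : ι) (f : Hurwitz ι K) :
    der v (der w f) = der w (der v f) := by
  ext L; simp [Multiset.cons_swap]

variable {ι K : Type*} [CommRing K]

instance : Zero (Hurwitz ι K) := ⟨⟨fun _ => 0⟩⟩
instance : Add (Hurwitz ι K) := ⟨fun f g => ⟨fun L => f L + g L⟩⟩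
instance : Neg (Hurwitz ι K) := ⟨fun f => ⟨fun L => -f L⟩⟩
instance : Sub (Hurwitz ι K) := ⟨fun f g => ⟨fun L => f L - g L⟩⟩
instance [Algebra ℚ K] : SMul ℚ (Hurwitz ι K) := ⟨fun a f => ⟨fun L => a • f L⟩⟩

@[simp] theorem coeff_add (f g : Hurwitz ι K) (L) : (f + g) L = f L + g L := rfl
@[simp] theorem coeff_sub (f g : Hurwitz ι K) (L) : (f - g) L = f L - g L := rfl
@[simp] theorem coeff_neg (f : Hurwitz ι K) (L) : (-f) L = -f L := rfl
@[simp] theorem coeff_zero (L) : (0 : Hurwitz ι K) L = 0 := rfl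
@[simp] theorem coeff_smul [Algebra ℚ K] (a : ℚ) (f : Hurwitz ι K) (L) :
    (a • f) L = a • f L := rfl

instance : AddCommGroup (Hurwitz ι K) where
  add_assoc f g h := by ext L; simp [add_assoc]
  zero_add f := by ext L; simp
  add_zero f := by ext L; simp
  neg_add_cancel f := by ext L; simp
  add_comm f g := by ext L; simp [add_comm]
  sub_eq_add_neg f g := by ext L; simp [sub_eq_add_neg]
  nsmul := nsmulRec
  zsmul := zsmulRec

instance [Algebra ℚ K] : Module ℚ (Hurwitz ι K) where
  one_smul f := by ext L; simp
  mul_smul a b f := by ext L; simp [mul_smul]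
  smul_zero a := by ext L; simp
  smul_add a f g := by ext L; simp
  add_smul a b f := by ext L; simp [add_smul]
  zero_smul f := by ext L; simp

theorem coeff_sum {α : Type*} (s : Finset α) (f : α → Hurwitz ι K) (L) :
    (∑ a ∈ s, f a) L = ∑ a ∈ s, f a L := by
  classical
  induction s using Finset.induction_on with
  | empty => simp
  | insert a s ha ih => simp [Finset.sum_insert ha, ih]

/-- The Leibniz rule at the origin: the splittings of a multiset are counted with multiplicity. -/
instance : Mul (Hurwitz ι K) where
  mul f g := ⟨fun L => (L.antidiagonal.map fun p => f p.1 * g p.2).sum⟩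

instance : One (Hurwitz ι K) where
  one := ⟨fun L => if L.card = 0 then 1 else 0⟩

theorem coeff_mul (f g : Hurwitz ι K) (L : Multiset ι) :
    (f * g) L = (L.antidiagonal.map fun p => f p.1 * g p.2).sum := rfl

theorem coeff_one (L : Multiset ι) : (1 : Hurwitz ι K) L = if L.card = 0 then 1 else 0 := rfl

theorem coeff_mul_zero (f g : Hurwitz ι K) : (f * g) 0 = f 0 * g 0 := by
  simp [coeff_mul]

theorem der_mul (v : ι) (f g : Hurwitz ι K) :
    der v (f * g) = f * der v g + der v f * g := by
  ext L
  simp [coeff_mul, Multiset.antidiagonal_cons, Multiset.map_map]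

theorem mul_cons (f g : Hurwitz ι K) (v : ι) (L : Multiset ι) :
    (f * g) (v ::ₘ L) = (f * der v g) L + (der v f * g) L := by
  rw [← der_apply, der_mul, coeff_add]

protected theorem add_mul (f g h : Hurwitz ι K) : (f + g) * h = f * h + g * h := by
  ext L; simp [coeff_mul, _root_.add_mul, Multiset.sum_map_add]

protected theorem mul_add (f g h : Hurwitz ι K) : f * (g + h) = f * g + f * h := by
  ext L; simp [coeff_mul, _root_.mul_add, Multiset.sum_map_add]

protected theorem mul_comm (f g : Hurwitz ι K) : f * g = g * f := by
  ext L
  induction L using Multiset.induction_on generalizing f g with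
  | empty => simp [coeff_mul_zero, _root_.mul_comm]
  | cons v L ih => rw [mul_cons, mul_cons, ih, ih (der v f), _root_.add_comm]

protected theorem mul_assoc (f g h : Hurwitz ι K) : f * g * h = f * (g * h) := by
  ext L
  induction L using Multiset.induction_on generalizing f g h with
  | empty => simp [coeff_mul_zero, _root_.mul_assoc]
  | cons v L ih =>
    simp only [mul_cons, der_mul, Hurwitz.add_mul, Hurwitz.mul_add, coeff_add, ih]
    abel

theorem der_one (v : ι) : der v (1 : Hurwitz ι K) = 0 := by
  ext L; simp [coeff_one]

protected theorem zero_mul (f : Hurwitz ι K) : 0 * f = 0 := by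
  ext L; simp [coeff_mul]

protected theorem one_mul (f : Hurwitz ι K) : 1 * f = f := by
  ext L
  induction L using Multiset.induction_on generalizing f with
  | empty => simp [coeff_mul_zero, coeff_one]
  | cons v L ih => simp [mul_cons, der_one, ih, Hurwitz.zero_mul]

instance : CommRing (Hurwitz ι K) where
  __ := (inferInstance : AddCommGroup (Hurwitz ι K))
  mul_assoc := Hurwitz.mul_assoc
  mul_comm := Hurwitz.mul_comm
  one_mul := Hurwitz.one_mul
  mul_one f := by rw [Hurwitz.mul_comm, Hurwitz.one_mul]
  left_distrib := Hurwitz.mul_add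
  right_distrib := Hurwitz.add_mul
  zero_mul := Hurwitz.zero_mul
  mul_zero f := by rw [Hurwitz.mul_comm, Hurwitz.zero_mul]
  zsmul := zsmulRec
  nsmul := nsmulRec

/-- A constant series. -/
def const (a : K) : Hurwitz ι K := ⟨fun L => if L.card = 0 then a else 0⟩

theorem const_mul_apply (a : K) (f : Hurwitz ι K) (L : Multiset ι) :
    (const a * f : Hurwitz ι K) L = a * f L := by
  induction L using Multiset.induction_on generalizing f with
  | empty => simp [coeff_mul_zero, const]
  | cons v L ih =>
    have : der v (const a : Hurwitz ι K) = 0 := by ext L; simp [const]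
    rw [mul_cons, ih, this, zero_mul]; simp

theorem const_one : (const 1 : Hurwitz ι K) = 1 := rfl

theorem const_mul (a b : K) : (const (a * b) : Hurwitz ι K) = const a * const b := by
  ext L; rw [const_mul_apply]; simp [const]

theorem der_const_mul (v : ι) (a : K) (f : Hurwitz ι K) :
    der v (const a * f) = const a * der v f := by
  ext L; simp [const_mul_apply]

/-- Splittings of the argument whose two parts do not both enter can be ignored. -/
theorem mul_congr {f f' g g' : Hurwitz ι K} {L : Multiset ι}
    (h : ∀ M N, M + N = L → f M * g N = f' M * g' N) : (f * g) L = (f' * g') L := by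
  rw [coeff_mul, coeff_mul]
  congr 1
  exact Multiset.map_congr rfl fun p hp => h _ _ (Multiset.mem_antidiagonal.1 hp)

/-- The splitting with empty first part occurs exactly once. -/
theorem mul_eq_of_left {f f' : Hurwitz ι K} {L : Multiset ι}
    {g : Hurwitz ι K} (h : ∀ M N, M + N = L → M ≠ 0 → f M * g N = f' M * g N) :
    (f * g) L - (f' * g) L = (f 0 - f' 0) * g L := by
  induction L using Multiset.induction_on generalizing f f' g with
  | empty => simp [coeff_mul_zero, _root_.sub_mul]
  | cons v L ih =>
    rw [mul_cons, mul_cons]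
    have h1 := ih (f := f) (f' := f') (g := der v g) fun M N hMN hM =>
      h M (v ::ₘ N) (by rw [Multiset.add_cons, hMN]) hM
    have h2 : (der v f * g) L = (der v f' * g) L := mul_congr fun M N hMN =>
      h (v ::ₘ M) N (by rw [Multiset.cons_add, hMN]) (Multiset.cons_ne_zero)
    rw [h2, add_sub_add_right_eq_sub, h1, der_apply]

theorem coeff_mul_mem {S : Type*} [SetLike S K] [AddSubmonoidClass S K] (s : S)
    {f g : Hurwitz ι K} {L : Multiset ι} (h : ∀ M N, M + N = L → f M * g N ∈ s) :
    (f * g) L ∈ s := by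
  rw [coeff_mul]
  refine multiset_sum_mem _ fun x hx => ?_
  obtain ⟨p, hp, rfl⟩ := Multiset.mem_map.1 hx
  exact h _ _ (Multiset.mem_antidiagonal.1 hp)

theorem pow_apply_eq_zero {h : Hurwitz ι K} (h0 : h 0 = 0) (n : ℕ) (L : Multiset ι)
    (hn : L.card < n) : (h ^ n) L = 0 := by
  induction n generalizing L with
  | zero => simp at hn
  | succ n ih =>
    have : (h ^ n * h) L ∈ (⊥ : AddSubgroup K) := by
      refine coeff_mul_mem _ fun M N hMN => ?_
      rw [AddSubgroup.mem_bot]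
      by_cases hM : M.card < n
      · rw [ih M hM, zero_mul]
      · have hN : N = 0 := by
          have := congrArg Multiset.card hMN
          rw [Multiset.card_add] at this
          rw [← Multiset.card_eq_zero]; omega
        rw [hN, h0, mul_zero]
    simpa [pow_succ] using this

section exp

variable [Algebra ℚ K]

/-- The exponential of a Hurwitz series without constant term; at each multiset only finitely many
powers contribute. -/
def exp (h : Hurwitz ι K) : Hurwitz ι K :=
  ⟨fun L => ∑ n ∈ Finset.range (L.card + 1), (n.factorial : ℚ)⁻¹ • (h ^ n) L⟩

theorem exp_apply_eq {h : Hurwitz ι K} (h0 : h 0 = 0) (L : Multiset ι) {N : ℕ}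
    (hN : L.card < N) :
    exp h L = (∑ n ∈ Finset.range N, (n.factorial : ℚ)⁻¹ • h ^ n : Hurwitz ι K) L := by
  rw [coeff_sum, exp]
  refine Finset.sum_subset (Finset.range_subset_range.2 hN) fun n _ hn => ?_
  rw [pow_apply_eq_zero h0 n L (by simpa using hn), smul_zero]

theorem exp_zero_apply (h : Hurwitz ι K) : exp h 0 = 1 := by
  simp [exp, coeff_one]

theorem smul_mul (a : ℚ) (f g : Hurwitz ι K) : (a • f) * g = a • (f * g) := by
  ext L
  rw [coeff_smul, coeff_mul, coeff_mul, Multiset.smul_sum, Multiset.map_map]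
  simp

/-- The chain rule for the exponential, for any derivation that does not raise the order of
vanishing by more than one. -/
theorem derivation_exp {h : Hurwitz ι K} (h0 : h 0 = 0)
    (δ : Hurwitz ι K →ₗ[ℚ] Hurwitz ι K)
    (hmul : ∀ f g, δ (f * g) = f * δ g + δ f * g)
    (hloc : ∀ f g L, (∀ M : Multiset ι, M.card ≤ L.card + 1 → f M = g M) → δ f L = δ g L) :
    δ (exp h) = exp h * δ h := by
  have hpow : ∀ n, δ (h ^ (n + 1)) = ((n + 1 : ℕ) : ℚ) • (h ^ n * δ h) := by
    have h1 : δ 1 = 0 := by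
      have := hmul 1 1
      simpa using this
    intro n
    induction n with
    | zero => simp
    | succ n ih =>
      rw [pow_succ, hmul, ih, smul_mul]
      rw [show h ^ n * δ h * h = h ^ (n + 1) * δ h by ring]
      push_cast
      rw [add_smul ((n : ℚ) + 1) 1, one_smul, add_comm]
  ext L
  have e1 : δ (exp h) L =
      δ (∑ n ∈ Finset.range (L.card + 2), (n.factorial : ℚ)⁻¹ • h ^ n) L :=
    hloc _ _ _ fun M hM => exp_apply_eq h0 M (by omega)
  have e2 : (exp h * δ h) L =
      ((∑ n ∈ Finset.range (L.card + 1), (n.factorial : ℚ)⁻¹ • h ^ n) * δ h) L := by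
    refine mul_congr fun M N hMN => ?_
    have := congrArg Multiset.card hMN
    rw [Multiset.card_add] at this
    rw [exp_apply_eq h0 M (N := L.card + 1) (by omega)]
  rw [e1, e2, Finset.sum_range_succ', map_add, map_sum, Finset.sum_mul]
  have h1 : δ 1 = 0 := by
    have := hmul 1 1
    simpa using this
  simp only [pow_zero, map_smul, h1, smul_zero, add_zero, hpow, smul_mul, smul_smul]
  congr 1
  refine Finset.sum_congr rfl fun n _ => ?_
  congr 1
  rw [Nat.factorial_succ]
  push_cast
  field_simp

/-- The derivative `der v` as a linear map. -/
def derₗ (v : ι) : Hurwitz ι K →ₗ[ℚ] Hurwitz ι K where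
  toFun := der v
  map_add' _ _ := rfl
  map_smul' _ _ := rfl

theorem der_exp {h : Hurwitz ι K} (h0 : h 0 = 0) (v : ι) :
    der v (exp h) = exp h * der v h :=
  derivation_exp h0 (derₗ v) (der_mul v) fun _ _ _ H => H _ (by simp)

/-- The exponential at `L` is `h L` plus a part depending on the values of `h` at smaller
multisets only. -/
theorem exp_sub_exp {h h' : Hurwitz ι K} (h0 : h 0 = 0) (h0' : h' 0 = 0) {m : ℕ}
    (H : ∀ L : Multiset ι, L.card < m → h L = h' L) :
    ∀ L : Multiset ι, L.card ≤ m → exp h L - exp h' L = h L - h' L := by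
  suffices ∀ n, n ≤ m → ∀ L : Multiset ι, L.card = n → exp h L - exp h' L = h L - h' L from
    fun L hL => this _ hL L rfl
  intro n
  induction n using Nat.strong_induction_on with
  | _ n ih =>
    intro hn L hL
    induction L using Multiset.induction_on with
    | empty => simp [exp_zero_apply, h0, h0']
    | cons v L _ =>
      rw [Multiset.card_cons] at hL
      rw [← der_apply, ← der_apply, der_exp h0, der_exp h0']
      have e : (exp h' * der v h') L = (exp h * der v h') L := mul_congr fun M N hMN => by
        have := congrArg Multiset.card hMN
        rw [Multiset.card_add] at this
        have h1 := ih M.card (by omega) (by omega) M rfl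
        rw [H M (by omega), sub_self, sub_eq_zero] at h1
        rw [h1]
      rw [e, ← coeff_sub, ← mul_sub]
      have := mul_eq_of_left (f := exp h) (f' := 0) (g := der v h - der v h') (L := L)
        fun M N hMN hM => by
          have hc := congrArg Multiset.card hMN
          rw [Multiset.card_add] at hc
          have : 0 < M.card := Multiset.card_pos.2 hM
          rw [coeff_sub, der_apply, der_apply, H (v ::ₘ N) (by rw [Multiset.card_cons]; omega)]
          simp
      rw [zero_mul] at this
      simpa [exp_zero_apply] using this

end exp

end Hurwitz

namespace MinimalGW

open Finset

noncomputable section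

/-! ### Symbols of differential operators -/

/-- The ring `A[D, z, z⁻¹]` of symbols of quantum differential operators; the basis element indexed
by `(i, k)` is `D^i z^k`. -/
abbrev Op (A : Type*) [CommRing A] : Type _ := AddMonoidAlgebra A (ℕ × ℤ)

namespace Op

variable {A : Type*} [CommRing A]

/-- The monomial `D^i z^k`. -/
def mon (i : ℕ) (k : ℤ) : Op A := AddMonoidAlgebra.single (i, k) 1

theorem mon_mul_single (i : ℕ) (k : ℤ) (p : ℕ × ℤ) (a : A) :
    mon i k * (AddMonoidAlgebra.single p a : Op A) =
      AddMonoidAlgebra.single (i + p.1, k + p.2) a := by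
  rw [mon, AddMonoidAlgebra.single_mul_single, one_mul]; rfl

theorem coeff_D_mul (x : Op A) (r : ℕ) (s : ℤ) :
    (mon 1 0 * x).coeff (r, s) = if r = 0 then 0 else x.coeff (r - 1, s) := by
  classical
  induction x using AddMonoidAlgebra.induction_linear with
  | zero => simp
  | add x y hx hy => rw [mul_add, AddMonoidAlgebra.coeff_add, Finsupp.add_apply, hx, hy]; aesop
  | single p a =>
    rw [mon_mul_single, AddMonoidAlgebra.coeff_single, AddMonoidAlgebra.coeff_single,
      Finsupp.single_apply, Finsupp.single_apply]
    obtain ⟨i, k⟩ := p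
    cases r with
    | zero => simp
    | succ r => simp [add_comm 1 i]

theorem mon_mul_mon (i j : ℕ) (k l : ℤ) :
    (mon i k * mon j l : Op A) = mon (i + j) (k + l) := mon_mul_single ..

theorem mon_zero : (mon 0 0 : Op A) = 1 := rfl

/-- The linear map with prescribed values on monomials. -/
def lift {M : Type*} [AddCommGroup M] [Module A M] (F : ℕ × ℤ → M) : Op A →ₗ[A] M :=
  (Finsupp.linearCombination A F).comp (AddMonoidAlgebra.coeffLinearEquiv A).toLinearMap

theorem lift_single {M : Type*} [AddCommGroup M] [Module A M] (F : ℕ × ℤ → M) (p : ℕ × ℤ) (a : A) :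
    lift F (AddMonoidAlgebra.single p a) = a • F p := by
  simp [lift]

/-- Symbols all of whose monomials have exponents in `S`. -/
def suppIn (A : Type*) [CommRing A] (S : Set (ℕ × ℤ)) : Submodule A (Op A) where
  carrier := {x | ∀ p, p ∉ S → x.coeff p = 0}
  zero_mem' := by simp
  add_mem' hx hy p hp := by simp [hx p hp, hy p hp]
  smul_mem' a x hx p hp := by simp [hx p hp]

theorem single_mem {S : Set (ℕ × ℤ)} {p : ℕ × ℤ} (hp : p ∈ S) (a : A) :
    (AddMonoidAlgebra.single p a : Op A) ∈ suppIn A S := by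
  classical
  intro q hq
  rw [AddMonoidAlgebra.coeff_single, Finsupp.single_apply, if_neg]
  rintro rfl; exact hq hp

theorem mon_mem {S : Set (ℕ × ℤ)} {i : ℕ} {k : ℤ} (hp : (i, k) ∈ S) :
    (mon i k : Op A) ∈ suppIn A S := single_mem hp 1

theorem suppIn_induction {S : Set (ℕ × ℤ)} {motive : Op A → Prop} {x : Op A}
    (hx : x ∈ suppIn A S) (zero : motive 0) (add : ∀ x y, motive x → motive y → motive (x + y))
    (single : ∀ p ∈ S, ∀ a, motive (AddMonoidAlgebra.single p a)) : motive x := by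
  rw [← AddMonoidAlgebra.sum_coeff_single x, Finsupp.sum]
  refine Finset.sum_induction _ motive add zero fun p hp => single p ?_ _
  by_contra h
  exact (Finsupp.mem_support_iff.1 hp) (hx p h)

theorem mul_mem_suppIn {S T U : Set (ℕ × ℤ)} (h : ∀ p ∈ S, ∀ q ∈ T, p + q ∈ U) {x y : Op A}
    (hx : x ∈ suppIn A S) (hy : y ∈ suppIn A T) : x * y ∈ suppIn A U := by
  refine suppIn_induction (motive := fun x => x * y ∈ suppIn A U) hx (by simp)
    (fun a b ha hb => by rw [add_mul]; exact add_mem ha hb)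
    fun p hp a => ?_
  refine suppIn_induction (motive := fun y => _ * y ∈ suppIn A U) hy (by simp)
    (fun a b ha hb => by rw [mul_add]; exact add_mem ha hb)
    fun q hq b => ?_
  rw [AddMonoidAlgebra.single_mul_single]
  exact single_mem (h p hp q hq) _

/-- Symbols of total degree at most `M`, where `D` and `z` have degree one. -/
def fil (A : Type*) [CommRing A] (M : ℤ) : Submodule A (Op A) := suppIn A {p | p.1 + p.2 ≤ M}

/-- Symbols that are polynomial in `z`. -/
def poly (A : Type*) [CommRing A] : Submodule A (Op A) := suppIn A {p | 0 ≤ p.2}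

theorem mem_fil {M : ℤ} {x : Op A} :
    x ∈ fil A M ↔ ∀ p : ℕ × ℤ, M < p.1 + p.2 → x.coeff p = 0 :=
  ⟨fun h p hp => h p (by simpa using hp), fun h p hp => h p (by simpa using hp)⟩

theorem fil_mono {M N : ℤ} (h : M ≤ N) {x : Op A} (hx : x ∈ fil A M) : x ∈ fil A N :=
  mem_fil.2 fun p hp => mem_fil.1 hx p (by omega)

theorem mul_mem_fil {M N : ℤ} {x y : Op A} (hx : x ∈ fil A M) (hy : y ∈ fil A N) :
    x * y ∈ fil A (M + N) :=
  mul_mem_suppIn (fun p hp q hq => by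
    simp only [Set.mem_ofPred_eq, Prod.fst_add, Prod.snd_add] at *; push_cast; omega) hx hy

theorem mul_mem_poly {x y : Op A} (hx : x ∈ poly A) (hy : y ∈ poly A) : x * y ∈ poly A :=
  mul_mem_suppIn (fun p hp q hq => by
    simp only [Set.mem_ofPred_eq, Prod.snd_add] at *; omega) hx hy

theorem mon_mem_fil {i : ℕ} {k M : ℤ} (h : i + k ≤ M) : (mon i k : Op A) ∈ fil A M := mon_mem h

theorem mon_mem_poly {i : ℕ} {k : ℤ} (h : 0 ≤ k) : (mon i k : Op A) ∈ poly A := mon_mem h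

theorem one_mem_poly : (1 : Op A) ∈ poly A := mon_mem_poly le_rfl

theorem exists_mem_fil (x : Op A) : ∃ n : ℕ, x ∈ fil A n := by
  induction x using AddMonoidAlgebra.induction_linear with
  | zero => exact ⟨0, zero_mem _⟩
  | single p a => exact ⟨(p.1 + p.2).toNat, single_mem (by simp) _⟩
  | add x y hx hy =>
    obtain ⟨m, hm⟩ := hx
    obtain ⟨n, hn⟩ := hy
    exact ⟨max m n, add_mem (fil_mono (by simp) hm) (fil_mono (by simp) hn)⟩

theorem eq_zero_of_mem_poly_of_mem_fil {M : ℤ} (hM : M < 0) {x : Op A} (hx : x ∈ poly A)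
    (hx' : x ∈ fil A M) : x = 0 := by
  ext p
  by_cases hp : 0 ≤ p.2
  · exact mem_fil.1 hx' p (by omega)
  · exact hx p hp

/-- The derivation of `A[D, z, z⁻¹]` that multiplies the monomials of exponent `p` by `ψ p`. -/
def wt (ψ : ℕ × ℤ →+ ℤ) : Op A →ₗ[A] Op A :=
  lift fun p => AddMonoidAlgebra.single p (ψ p : A)

theorem wt_single (ψ : ℕ × ℤ →+ ℤ) (p : ℕ × ℤ) (a : A) :
    wt ψ (AddMonoidAlgebra.single p a : Op A) = AddMonoidAlgebra.single p ((ψ p : A) * a) := by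
  rw [wt, lift_single, AddMonoidAlgebra.smul_single, smul_eq_mul, mul_comm]

theorem coeff_wt (ψ : ℕ × ℤ →+ ℤ) (x : Op A) (p : ℕ × ℤ) :
    (wt ψ x).coeff p = ψ p * x.coeff p := by
  classical
  induction x using AddMonoidAlgebra.induction_linear with
  | zero => simp
  | add x y hx hy => simp [hx, hy, mul_add]
  | single q a =>
    rw [wt_single]
    simp only [AddMonoidAlgebra.coeff_single, Finsupp.single_apply]
    split_ifs with h <;> simp [h]

theorem wt_mul (ψ : ℕ × ℤ →+ ℤ) (x y : Op A) : wt ψ (x * y) = x * wt ψ y + wt ψ x * y := by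
  induction x using AddMonoidAlgebra.induction_linear with
  | zero => simp
  | add x x' hx hx' => simp only [add_mul, map_add, hx, hx']; abel
  | single p a =>
    induction y using AddMonoidAlgebra.induction_linear with
    | zero => simp
    | add y y' hy hy' => simp only [mul_add, map_add, hy, hy']; abel
    | single q b =>
      simp only [AddMonoidAlgebra.single_mul_single, wt_single, ← AddMonoidAlgebra.single_add]
      congr 1
      push_cast [map_add]
      ring

theorem wt_mem_suppIn (ψ : ℕ × ℤ →+ ℤ) {S : Set (ℕ × ℤ)} {x : Op A} (hx : x ∈ suppIn A S) :
    wt ψ x ∈ suppIn A S := fun p hp => by rw [coeff_wt, hx p hp, mul_zero]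

/-- The total degree as a weight. -/
def degWt : ℕ × ℤ →+ ℤ where
  toFun p := p.1 + p.2
  map_zero' := by simp
  map_add' p q := by simp; ring

/-- The degree in `D` as a weight. -/
def dWt : ℕ × ℤ →+ ℤ where
  toFun p := p.1
  map_zero' := by simp
  map_add' p q := by simp

end Op

/-! ### The J-function and its derivatives -/

/-- The coefficients `c d r` of a homogeneous series
`J = ∑_{d, r} c d r • q^d H^r z^{-d-r}` in `1 + O(z⁻²)` whose part of order zero in `q` is `1`. -/
structure JFun (A : Type*) [CommRing A] where
  /-- The coefficient of `q^d H^r z^{-d-r}`. -/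
  c : ℤ → ℕ → A
  neg : ∀ d r, d < 0 → c d r = 0
  zero : ∀ r, c 0 r = if r = 0 then 1 else 0
  one : c 1 0 = 0

namespace JFun

open Op

variable {A : Type*} [CommRing A] (J : JFun A)

/-- The coefficient of `q^d H^r` in `(H + z q ∂_q)^i J`, up to a power of `z`. -/
def beta : ℕ → ℤ → ℕ → A
  | 0, d, r => J.c d r
  | i + 1, d, 0 => d * beta i d 0
  | i + 1, d, r + 1 => beta i d r + d * beta i d (r + 1)

theorem beta_neg (i : ℕ) (d : ℤ) (r : ℕ) (hd : d < 0) : J.beta i d r = 0 := by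
  induction i generalizing r with
  | zero => exact J.neg d r hd
  | succ i ih => cases r <;> simp [beta, ih]

theorem beta_zero (i r : ℕ) : J.beta i 0 r = if r = i then 1 else 0 := by
  induction i generalizing r with
  | zero => exact J.zero r
  | succ i ih => cases r <;> simp [beta, ih]

/-- `J.co r s x` is the coefficient of `H^r z^s` in `x J` at `q = 1`, where `D` acts as the
differential operator `H + z q ∂_q` and the powers of `q` in `x` stand to the left. By homogeneity
the exponent of `q` is determined by the other ones. -/
def co (r : ℕ) (s : ℤ) : Op A →ₗ[A] A := lift fun p => J.beta p.1 (p.1 + p.2 - r - s) r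

theorem co_single (r : ℕ) (s : ℤ) (p : ℕ × ℤ) (a : A) :
    J.co r s (AddMonoidAlgebra.single p a) = a * J.beta p.1 (p.1 + p.2 - r - s) r := by
  rw [co, lift_single, smul_eq_mul]

theorem co_mon (r : ℕ) (s : ℤ) (i : ℕ) (k : ℤ) :
    J.co r s (mon i k) = J.beta i (i + k - r - s) r := by
  rw [mon, co_single, one_mul]

theorem co_z_mul (r : ℕ) (s m : ℤ) (x : Op A) : J.co r s (mon 0 m * x) = J.co r (s - m) x := by
  induction x using AddMonoidAlgebra.induction_linear with
  | zero => simp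
  | add x y hx hy => simp only [mul_add, map_add, hx, hy]
  | single p a =>
    rw [mon_mul_single, co_single, co_single]
    simp only [zero_add]
    congr 2; ring

/-- The coefficient of `H^{r-1} z^s`, which vanishes for `r = 0`. -/
def coPred (r : ℕ) (s : ℤ) (x : Op A) : A := if r = 0 then 0 else J.co (r - 1) s x

/-- Multiplication by `D` is the action of the operator `H + z q ∂_q`; the exponent of `q` is the
total degree in `D` and `z` minus the total degree in `H` and `z`. -/
theorem co_D_mul (r : ℕ) (s : ℤ) (x : Op A) :
    J.co r s (mon 1 0 * x) = J.coPred r s x + J.co r (s - 1) (wt degWt x)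
      - (r + s - 1 : ℤ) * J.co r (s - 1) x := by
  induction x using AddMonoidAlgebra.induction_linear with
  | zero => simp [coPred]
  | add x y hx hy =>
    simp only [mul_add, map_add, hx, hy, coPred]
    split_ifs <;> ring
  | single p a =>
    rw [mon_mul_single, wt_single]
    simp only [coPred, co_single, add_comm 1 p.1, zero_add]
    cases r with
    | zero =>
      simp only [beta, if_true]
      rw [show ((p.1 + 1 : ℕ) : ℤ) + p.2 - (0 : ℕ) - s = p.1 + p.2 - (0 : ℕ) - (s - 1) by
        push_cast; ring]
      simp only [degWt, AddMonoidHom.coe_mk, ZeroHom.coe_mk]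
      push_cast
      ring
    | succ r =>
      simp only [beta, if_false, Nat.succ_ne_zero, Nat.add_sub_cancel]
      rw [show ((p.1 + 1 : ℕ) : ℤ) + p.2 - (r + 1 : ℕ) - s = p.1 + p.2 - r - s by
        push_cast; ring,
        show (p.1 : ℤ) + p.2 - (r + 1 : ℕ) - (s - 1) = p.1 + p.2 - r - s by push_cast; ring]
      simp only [degWt, AddMonoidHom.coe_mk, ZeroHom.coe_mk]
      push_cast
      ring

theorem co_eq_zero {M s : ℤ} {r : ℕ} {x : Op A} (hx : x ∈ fil A M) (h : M < r + s) :
    J.co r s x = 0 := by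
  refine suppIn_induction (motive := fun x => J.co r s x = 0) hx (map_zero _)
    (fun x y hx hy => by simp [hx, hy]) fun p hp a => ?_
  simp only [Set.mem_ofPred_eq] at hp
  rw [co_single, beta_neg _ _ _ _ (by omega), mul_zero]

/-- In top degree the passage from a symbol to its action on `J` replaces `D` by `H`. -/
theorem co_top {M s : ℤ} {r : ℕ} {x : Op A} (hx : x ∈ fil A M) (h : r + s = M) :
    J.co r s x = x.coeff (r, s) := by
  classical
  refine suppIn_induction (motive := fun x => J.co r s x = x.coeff (r, s)) hx (by simp)
    (fun x y hx hy => by simp [hx, hy]) fun p hp a => ?_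
  simp only [Set.mem_ofPred_eq] at hp
  rw [co_single, AddMonoidAlgebra.coeff_single, Finsupp.single_apply]
  rcases hp.lt_or_eq with hp | hp
  · rw [beta_neg _ _ _ _ (by omega), mul_zero, if_neg]
    rintro rfl
    simp at hp
    omega
  · rw [show (p.1 : ℤ) + p.2 - r - s = 0 by omega, beta_zero]
    have : r = p.1 ↔ p = (r, s) := by
      rw [Prod.ext_iff]
      constructor
      · intro h'; refine ⟨h'.symm, ?_⟩; simp only; omega
      · intro h'; exact h'.1.symm
    simp [this]

theorem mem_fil_pred {M : ℤ} {x : Op A} (hx : x ∈ poly A) (hx' : x ∈ fil A M)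
    (h : ∀ (r : ℕ) (s : ℤ), 0 ≤ s → r + s = M → J.co r s x = 0) : x ∈ fil A (M - 1) := by
  refine mem_fil.2 fun p hp => ?_
  rcases (show M ≤ p.1 + p.2 by omega).lt_or_eq with h1 | h1
  · exact mem_fil.1 hx' p h1
  · by_cases h2 : 0 ≤ p.2
    · rw [← J.co_top hx' h1.symm]; exact h _ _ h2 h1.symm
    · exact hx p h2

/-- A symbol polynomial in `z` is determined by the part of its action on `J` that is polynomial
in `z`. -/
theorem eq_zero_of_co {x : Op A} (hx : x ∈ poly A) (h : ∀ (r : ℕ) (s : ℤ), 0 ≤ s → J.co r s x = 0) :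
    x = 0 := by
  obtain ⟨n, hn⟩ := exists_mem_fil x
  have key : ∀ m : ℕ, x ∈ fil A ((n : ℤ) - m) := by
    intro m
    induction m with
    | zero => simpa using hn
    | succ m ih =>
      have := J.mem_fil_pred hx ih fun r s hs _ => h r s hs
      rwa [show (n : ℤ) - (m + 1 : ℕ) = n - m - 1 by push_cast; ring]
  exact eq_zero_of_mem_poly_of_mem_fil (by push_cast; omega) hx (key (n + 1))

/-- Every polynomial in `H` and `z` is the polynomial part of the action on `J` of a symbol that is
polynomial in `z`. -/
theorem exists_co_eq (M : ℤ) (h : ℕ → ℤ → A)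
    (hh : ∀ (r : ℕ) (s : ℤ), 0 ≤ s → M < r + s → h r s = 0) :
    ∃ x ∈ poly A, x ∈ fil A M ∧ ∀ (r : ℕ) (s : ℤ), 0 ≤ s → J.co r s x = h r s := by
  rcases lt_or_ge M 0 with hM | hM
  · refine ⟨0, zero_mem _, zero_mem _, fun r s hs => ?_⟩
    rw [map_zero, hh r s hs (by omega)]
  lift M to ℕ using hM
  induction M using Nat.strong_induction_on generalizing h with
  | _ M ih =>
    set x₀ : Op A := ∑ i ∈ range (M + 1), h i (M - i) • mon i (M - i) with hx₀
    have hp : x₀ ∈ poly A := Submodule.sum_mem _ fun i hi => Submodule.smul_mem _ _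
      (mon_mem_poly (by simp at hi; omega))
    have hf : x₀ ∈ fil A M := Submodule.sum_mem _ fun i hi => Submodule.smul_mem _ _
      (mon_mem_fil (by omega))
    have htop : ∀ (r : ℕ) (s : ℤ), 0 ≤ s → (M : ℤ) ≤ r + s → J.co r s x₀ = h r s := by
      intro r s hs hrs
      rcases hrs.lt_or_eq with h1 | h1
      · rw [J.co_eq_zero hf h1, hh r s hs h1]
      · rw [hx₀, map_sum, Finset.sum_eq_single r]
        · rw [map_smul, co_mon, show (r : ℤ) + (M - r) - r - s = 0 by omega, beta_zero, if_pos rfl,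
            smul_eq_mul, mul_one, show (M : ℤ) - r = s by omega]
        · intro i _ hi
          rw [map_smul, co_mon, show (i : ℤ) + (M - i) - r - s = 0 by omega, beta_zero,
            if_neg (Ne.symm hi), smul_zero]
        · intro hr
          simp at hr
          omega
    have hrest : ∀ (r : ℕ) (s : ℤ), 0 ≤ s → (M : ℤ) - 1 < r + s →
        h r s - J.co r s x₀ = 0 := fun r s hs hrs =>
      sub_eq_zero.2 (htop r s hs (by omega)).symm
    obtain ⟨y, hy, hy', hy''⟩ : ∃ y ∈ poly A, y ∈ fil A (M - 1 : ℤ) ∧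
        ∀ (r : ℕ) (s : ℤ), 0 ≤ s → J.co r s y = h r s - J.co r s x₀ := by
      rcases Nat.eq_zero_or_pos M with h0 | h0
      · refine ⟨0, zero_mem _, zero_mem _, fun r s hs => ?_⟩
        rw [map_zero, hrest r s hs (by subst h0; push_cast; omega)]
      · obtain ⟨y, h1, h2, h3⟩ := ih (M - 1) (by omega) (fun r s => h r s - J.co r s x₀)
          fun r s hs hrs => hrest r s hs (by push_cast [h0] at hrs; omega)
        exact ⟨y, h1, by rwa [Nat.cast_sub h0] at h2, h3⟩
    refine ⟨x₀ + y, add_mem hp hy, add_mem hf (fil_mono (by omega) hy'), fun r s hs => ?_⟩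
    rw [map_add, hy'' r s hs]; ring

end JFun

/-! ### The cone of the theory -/

/-- The contribution `∑ (d_s + i_s - 1)` of the insertions `τ_{d_s} H^{i_s}` to the degree. -/
def nw (L : Multiset (ℕ × ℕ)) : ℤ := (L.map fun v => (v.1 + v.2 - 1 : ℤ)).sum

@[simp] theorem nw_zero : nw 0 = 0 := rfl

@[simp] theorem nw_cons (v : ℕ × ℕ) (L) : nw (v ::ₘ L) = v.1 + v.2 - 1 + nw L := by simp [nw]

theorem nw_add (L M) : nw (L + M) = nw L + nw M := by simp [nw]

namespace JFun

open Op

variable {A : Type*} [CommRing A]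

/-- The Taylor coefficients of the coordinate `z + ∑ t_{d,i} (-z)^d H^i`: the prescribed part of
the points of the cone that is polynomial in `z`. -/
def tgt (A : Type*) [CommRing A] (L : Multiset (ℕ × ℕ)) (r : ℕ) (s : ℤ) : A :=
  if L.card = 0 then if r = 0 ∧ s = 1 then 1 else 0
  else if L.card = 1 then (L.map fun v => if r = v.2 ∧ s = v.1 then (-1) ^ v.1 else 0).sum
  else 0

theorem tgt_zero (r : ℕ) (s : ℤ) : tgt A 0 r s = if r = 0 ∧ s = 1 then 1 else 0 := by simp [tgt]

theorem tgt_singleton (v : ℕ × ℕ) (r : ℕ) (s : ℤ) :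
    tgt A {v} r s = if r = v.2 ∧ s = v.1 then (-1) ^ v.1 else 0 := by simp [tgt]

theorem tgt_eq_zero {L : Multiset (ℕ × ℕ)} {r : ℕ} {s : ℤ} (h : nw L + 1 ≠ r + s) :
    tgt A L r s = 0 := by
  unfold tgt
  split_ifs with h1 h2 h3
  · rw [Multiset.card_eq_zero] at h1
    subst h1
    simp [h2] at h
  · rfl
  · obtain ⟨v, rfl⟩ := Multiset.card_eq_one.1 h3
    rw [Multiset.map_singleton, Multiset.sum_singleton, if_neg]
    rintro ⟨rfl, rfl⟩
    apply h
    simp [nw]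
    ring
  · rfl

section Fil

variable {e e' : ℤ} {f g : Hurwitz (ℕ × ℕ) (Op A)}

theorem mul_mem_filtration (hf : ∀ L, f L ∈ fil A (nw L + e)) (hg : ∀ L, g L ∈ fil A (nw L + e'))
    (L) : (f * g) L ∈ fil A (nw L + (e + e')) := by
  refine Hurwitz.coeff_mul_mem _ fun M N h => ?_
  rw [← h, nw_add, show nw M + nw N + (e + e') = nw M + e + (nw N + e') by ring]
  exact mul_mem_fil (hf M) (hg N)

theorem const_mul_mem_filtration {x : Op A} (hx : x ∈ fil A e) (hf : ∀ L, f L ∈ fil A (nw L + e'))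
    (L : Multiset (ℕ × ℕ)) :
    (Hurwitz.const x * f : Hurwitz (ℕ × ℕ) (Op A)) L ∈ fil A (nw L + (e + e')) := by
  rw [Hurwitz.const_mul_apply, show nw L + (e + e') = e + (nw L + e') by ring]
  exact mul_mem_fil hx (hf L)

theorem mul_mem_hpoly (hf : ∀ L, f L ∈ poly A) (hg : ∀ L, g L ∈ poly A) (L) :
    (f * g) L ∈ poly A :=
  Hurwitz.coeff_mul_mem _ fun M N _ => mul_mem_poly (hf M) (hg N)

theorem one_mem_filtration (L) : (1 : Hurwitz (ℕ × ℕ) (Op A)) L ∈ fil A (nw L + 0) := by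
  rw [Hurwitz.coeff_one]
  split_ifs with h
  · rw [Multiset.card_eq_zero] at h
    subst h
    exact mon_mem_fil (by simp)
  · exact zero_mem _

theorem pow_mem_filtration (hf : ∀ L, f L ∈ fil A (nw L + 0)) (n : ℕ) (L) :
    (f ^ n) L ∈ fil A (nw L + 0) := by
  induction n generalizing L with
  | zero => exact one_mem_filtration L
  | succ n ih => rw [pow_succ]; exact mul_mem_filtration ih hf L

end Fil

theorem mon_one_mul_mon_neg_one_mul (x : Op A) : mon 0 1 * (mon 0 (-1) * x) = x := by
  rw [← mul_assoc, mon_mul_mon]; simp [mon_zero]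

theorem const_mul_zero_apply {g : Hurwitz (ℕ × ℕ) (Op A)} (h0 : g 0 = 0) (x : Op A) :
    (Hurwitz.const x * g : Hurwitz (ℕ × ℕ) (Op A)) 0 = 0 := by
  rw [Hurwitz.const_mul_apply, h0, mul_zero]

variable [Algebra ℚ A]

/-- The symbol `exp (g / z)`. -/
def expz (g : Hurwitz (ℕ × ℕ) (Op A)) : Hurwitz (ℕ × ℕ) (Op A) :=
  Hurwitz.exp (Hurwitz.const (mon 0 (-1)) * g)

theorem rat_smul_mem (S : Submodule A (Op A)) (q : ℚ) {x : Op A} (hx : x ∈ S) : q • x ∈ S := by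
  rw [← algebraMap_smul A q x]
  exact S.smul_mem _ hx

theorem expz_mem_fil {g : Hurwitz (ℕ × ℕ) (Op A)} (hf : ∀ L, g L ∈ fil A (nw L + 1)) (L) :
    expz g L ∈ fil A (nw L + 0) := by
  refine Submodule.sum_mem _ fun n _ => rat_smul_mem _ _ (pow_mem_filtration (fun L => ?_) n L)
  exact const_mul_mem_filtration (e := -1) (e' := 1) (mon_mem_fil (M := -1) (by simp)) hf L

variable (J : JFun A)

/-- `g` parametrizes the cone up to order `n`: the point `z exp(g / z) J` has the prescribed
polynomial part. -/
structure IsSolution (n : ℕ∞) (g : Hurwitz (ℕ × ℕ) (Op A)) : Prop where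
  zero : g 0 = 0
  poly : ∀ L, g L ∈ poly A
  fil : ∀ L, g L ∈ fil A (nw L + 1)
  co : ∀ L, L.card ≤ n → ∀ (r : ℕ) (s : ℤ), 0 ≤ s → J.co r s (mon 0 1 * expz g L) = tgt A L r s

theorem isSolution_zero : J.IsSolution (0 : ℕ) 0 where
  zero := rfl
  poly L := zero_mem _
  fil L := zero_mem _
  co L hL r s hs := by
    obtain rfl : L = 0 := by simpa using hL
    rw [expz, Hurwitz.exp_zero_apply, mul_one, co_mon, tgt_zero]
    simp only [beta]
    split_ifs with h
    · rw [h.1, h.2]; simp [J.zero]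
    · rcases lt_or_ge (((0 : ℕ) : ℤ) + 1 - r - s) 0 with h1 | h1
      · exact J.neg _ _ h1
      · by_cases hr : r = 0
        · obtain rfl : s = 0 := by omega
          subst hr
          simpa using J.one
        · obtain rfl : s = 0 := by omega
          obtain rfl : r = 1 := by omega
          simp [J.zero]

/-- A solution up to order `n` extends to order `n + 1`: the values of `g` at multisets of
cardinality `n + 1` enter the polynomial part linearly, up to terms of lower order, and can be
prescribed by `exists_co_eq`. -/
theorem IsSolution.step {n : ℕ} {g : Hurwitz (ℕ × ℕ) (Op A)} (h : J.IsSolution n g) :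
    ∃ g', J.IsSolution (n + 1 : ℕ) g' ∧ ∀ L : Multiset (ℕ × ℕ), L.card ≤ n → g' L = g L := by
  have hz : ∀ L, mon 0 1 * expz g L ∈ Op.fil A (nw L + 1) := fun L => by
    rw [add_comm]
    exact mul_mem_fil (mon_mem_fil (M := 1) (by simp)) (by simpa using expz_mem_fil h.fil L)
  choose Q hQ1 hQ2 hQ3 using fun L : Multiset (ℕ × ℕ) =>
    J.exists_co_eq (nw L + 1) (fun r s => tgt A L r s - J.co r s (mon 0 1 * expz g L))
      fun r s hs hrs => by
        rw [tgt_eq_zero (by omega), J.co_eq_zero (hz L) hrs, sub_zero]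
  let g' : Hurwitz (ℕ × ℕ) (Op A) := ⟨fun L => if L.card = n + 1 then g L + Q L else g L⟩
  have hg' : ∀ L : Multiset (ℕ × ℕ), L.card ≤ n → g' L = g L := fun L hL =>
    if_neg (by omega)
  have hg'' : ∀ L : Multiset (ℕ × ℕ), L.card = n + 1 → g' L = g L + Q L := fun L hL => if_pos hL
  have h0 : g' 0 = 0 := by rw [hg' 0 (by simp), h.zero]
  have hE : ∀ L : Multiset (ℕ × ℕ), L.card ≤ n + 1 →
      mon 0 1 * expz g' L = mon 0 1 * expz g L + (g' L - g L) := by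
    intro L hL
    have := Hurwitz.exp_sub_exp (const_mul_zero_apply h0 (mon 0 (-1)))
      (const_mul_zero_apply h.zero (mon 0 (-1))) (m := n + 1)
      (fun M hM => by simp only [Hurwitz.const_mul_apply, hg' M (by omega)]) L hL
    rw [Hurwitz.const_mul_apply, Hurwitz.const_mul_apply, ← mul_sub] at this
    rw [← mon_one_mul_mon_neg_one_mul (g' L - g L), ← this]
    simp only [expz]
    ring
  refine ⟨g', ⟨h0, fun L => ?_, fun L => ?_, fun L hL r s hs => ?_⟩, hg'⟩
  · by_cases hL : L.card = n + 1
    · rw [hg'' L hL]; exact add_mem (h.poly L) (hQ1 L)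
    · simp only [g', if_neg hL]; exact h.poly L
  · by_cases hL : L.card = n + 1
    · rw [hg'' L hL]; exact add_mem (h.fil L) (hQ2 L)
    · simp only [g', if_neg hL]; exact h.fil L
  · have hL' : L.card ≤ n + 1 := by exact_mod_cast hL
    rw [hE L hL', map_add]
    rcases hL'.lt_or_eq with h1 | h1
    · rw [hg' L (by omega), sub_self, map_zero, add_zero,
        h.co L (by exact_mod_cast (show L.card ≤ n by omega)) r s hs]
    · rw [hg'' L h1, add_sub_cancel_left, hQ3 L r s hs]; ring

/-- The solutions of finite order glue, because a step of the construction only changes `g` at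
multisets of the next cardinality. -/
theorem exists_isSolution : ∃ g, J.IsSolution ⊤ g := by
  choose F hF hF' using fun (n : ℕ) (g : {g // J.IsSolution n g}) => g.2.step
  let G : ∀ n : ℕ, {g // J.IsSolution n g} := fun n =>
    Nat.rec (motive := fun n => {g // J.IsSolution n g}) ⟨0, J.isSolution_zero⟩
      (fun n g => ⟨F n g, hF n g⟩) n
  have hG : ∀ n, ∀ L : Multiset (ℕ × ℕ), L.card ≤ n → (G (n + 1)).1 L = (G n).1 L :=
    fun n => hF' n (G n)
  have hG' : ∀ n m, n ≤ m → ∀ L : Multiset (ℕ × ℕ), L.card ≤ n → (G m).1 L = (G n).1 L := by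
    intro n m hnm L hL
    induction m, hnm using Nat.le_induction with
    | base => rfl
    | succ m hm ih => rw [hG m L (by omega), ih]
  let g : Hurwitz (ℕ × ℕ) (Op A) := ⟨fun L => (G L.card).1 L⟩
  have hg : ∀ n, ∀ L : Multiset (ℕ × ℕ), L.card ≤ n → g L = (G n).1 L :=
    fun n L hL => (hG' _ n hL L le_rfl).symm
  have h0 : g 0 = 0 := (G (0 : Multiset (ℕ × ℕ)).card).2.zero
  refine ⟨g, h0, fun L => (G _).2.poly L, fun L => (G _).2.fil L, fun L _ r s hs => ?_⟩
  have := Hurwitz.exp_sub_exp (const_mul_zero_apply h0 (mon 0 (-1)))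
      (const_mul_zero_apply (G L.card).2.zero (mon 0 (-1))) (m := L.card + 1)
      (fun M hM => by simp only [Hurwitz.const_mul_apply, hg L.card M (by omega)]) L (by omega)
  rw [Hurwitz.const_mul_apply, Hurwitz.const_mul_apply, hg L.card L le_rfl, sub_self,
    sub_eq_zero] at this
  rw [← (G L.card).2.co L le_rfl r s hs, expz, this, expz]

/-- The parametrization of the cone by flat coordinates. -/
def g : Hurwitz (ℕ × ℕ) (Op A) := J.exists_isSolution.choose

theorem isSolution_g : J.IsSolution ⊤ J.g := J.exists_isSolution.choose_spec

/-- The symbol `exp (g / z)`; it maps the tangent space of the cone at the origin to the tangent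
space at the point with flat coordinates `t`. -/
def E : Hurwitz (ℕ × ℕ) (Op A) := expz J.g

/-- The symbol `z exp (g / z)` of the general point of the cone. -/
def f : Hurwitz (ℕ × ℕ) (Op A) := Hurwitz.const (mon 0 1) * J.E

theorem E_zero : J.E 0 = 1 := Hurwitz.exp_zero_apply _

theorem f_apply (L) : J.f L = mon 0 1 * J.E L := Hurwitz.const_mul_apply ..

theorem E_apply (L) : J.E L = mon 0 (-1) * J.f L := by
  rw [f_apply, ← mul_assoc, mon_mul_mon]; simp [mon_zero]

theorem co_f (L) (r : ℕ) (s : ℤ) (hs : 0 ≤ s) : J.co r s (J.f L) = tgt A L r s := by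
  rw [f_apply]; exact J.isSolution_g.co L le_top r s hs

theorem E_mem_fil (L) : J.E L ∈ fil A (nw L + 0) := expz_mem_fil J.isSolution_g.fil L

theorem f_mem_fil (L) : J.f L ∈ fil A (nw L + 1) :=
  const_mul_mem_filtration (e := 1) (e' := 0) (mon_mem_fil (by simp)) J.E_mem_fil L

theorem z_mul_E_mul (Y : Hurwitz (ℕ × ℕ) (Op A)) :
    Hurwitz.const (mon 0 1) * (J.E * (Hurwitz.const (mon 0 (-1)) * Y)) = J.E * Y := by
  rw [mul_left_comm, ← mul_assoc (Hurwitz.const (mon 0 1)), ← Hurwitz.const_mul, mon_mul_mon]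
  simp [mon_zero, Hurwitz.const_one]

theorem der_f (v : ℕ × ℕ) : Hurwitz.der v J.f = J.E * Hurwitz.der v J.g := by
  rw [f, Hurwitz.der_const_mul, E, expz,
    Hurwitz.der_exp (const_mul_zero_apply J.isSolution_g.zero _), Hurwitz.der_const_mul]
  exact J.z_mul_E_mul _

/-- A vector field along the cone vanishes at `L` if its polynomial part vanishes at all smaller
multisets. -/
theorem E_mul_eq_zero {Y : Hurwitz (ℕ × ℕ) (Op A)} (hY : ∀ L, Y L ∈ poly A)
    {L : Multiset (ℕ × ℕ)} (h : ∀ M ≤ L, ∀ (r : ℕ) (s : ℤ), 0 ≤ s → J.co r s ((J.E * Y) M) = 0) :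
    (J.E * Y) L = 0 := by
  -- If `Y` vanishes below `M`, then `E * Y` agrees with `Y` at `M`, and `Y` is polynomial in `z`.
  have key : ∀ n, ∀ M ≤ L, M.card = n → Y M = 0 := by
    intro n
    induction n using Nat.strong_induction_on with
    | _ n ih =>
      intro M hM hn
      have h1 : (J.E * Y) M = Y M := by
        have := Hurwitz.mul_eq_of_left (f := J.E) (f' := 0) (g := Y) (L := M) fun M' N hMN hM' => by
          have hc := congrArg Multiset.card hMN
          rw [Multiset.card_add] at hc
          have : 0 < M'.card := Multiset.card_pos.2 hM'
          rw [ih N.card (by omega) N (le_trans (hMN ▸ Multiset.le_add_left N M') hM) rfl]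
          simp
        simpa [E_zero] using this
      refine J.eq_zero_of_co (hY M) fun r s hs => ?_
      rw [← h1]
      exact h M hM r s hs
  have : (J.E * Y) L ∈ (⊥ : Submodule A (Op A)) := Hurwitz.coeff_mul_mem _ fun M N hMN => by
    rw [key _ N (hMN ▸ Multiset.le_add_left N M) rfl]; simp
  simpa using this

/-- The version of `E_mul_eq_zero` for the parts of top degree. -/
theorem E_mul_mem_fil_pred {Y : Hurwitz (ℕ × ℕ) (Op A)} {e : ℤ} (hY : ∀ L, Y L ∈ poly A)
    (hY' : ∀ L, Y L ∈ fil A (nw L + e))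
    (h : ∀ L (r : ℕ) (s : ℤ), 0 ≤ s → r + s = nw L + e → J.co r s ((J.E * Y) L) = 0) (L) :
    (J.E * Y) L ∈ fil A (nw L + (e - 1)) := by
  have key : ∀ n, ∀ M : Multiset (ℕ × ℕ), M.card = n → Y M ∈ fil A (nw M + (e - 1)) := by
    intro n
    induction n using Nat.strong_induction_on with
    | _ n ih =>
      intro M hn
      have h1 : (J.E * Y) M - Y M ∈ fil A (nw M + (e - 1)) := by
        let Z : Hurwitz (ℕ × ℕ) (Op A) := ⟨fun N => if N.card < n then Y N else 0⟩
        have h2 : (J.E * Y) M - Y M = (J.E * Z) M := by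
          have := Hurwitz.mul_eq_of_left (f := J.E) (f' := 0) (g := Y - Z) (L := M)
            fun M' N hMN hM' => by
              have hc := congrArg Multiset.card hMN
              rw [Multiset.card_add] at hc
              have : 0 < M'.card := Multiset.card_pos.2 hM'
              simp only [Hurwitz.coeff_sub, Z, if_pos (show N.card < n by omega)]
              simp
          have hZ : Z M = 0 := if_neg (by omega)
          rw [mul_sub, zero_mul] at this
          simp only [Hurwitz.coeff_sub, E_zero, hZ, Hurwitz.coeff_zero, sub_zero, one_mul] at this
          rw [← this]; ring
        rw [h2, show nw M + (e - 1) = nw M + (0 + (e - 1)) by ring]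
        refine mul_mem_filtration J.E_mem_fil (fun N => ?_) M
        simp only [Z]
        split_ifs with hN
        · exact ih _ hN N rfl
        · exact zero_mem _
      rw [show nw M + (e - 1) = nw M + e - 1 by ring] at h1 ⊢
      refine J.mem_fil_pred (hY M) (hY' M) fun r s hs hrs => ?_
      have h3 := J.co_eq_zero h1 (r := r) (s := s) (by omega)
      rw [map_sub, h M r s hs hrs, zero_sub, neg_eq_zero] at h3
      exact h3
  rw [show nw L + (e - 1) = nw L + (0 + (e - 1)) by ring]
  exact mul_mem_filtration J.E_mem_fil (fun N => key _ N rfl) L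

end JFun

end

end MinimalGW

namespace Hurwitz

/-! ### Vector fields on Hurwitz series -/

variable {K : Type*} [CommRing K]

/-- The vector field `∑ t_{d,i} ∂/∂t_{d-1,i+k}`, summed over `d > 0`. -/
def lam (k : ℕ) (X : Hurwitz (ℕ × ℕ) K) : Hurwitz (ℕ × ℕ) K :=
  ⟨fun L => (L.map fun v =>
    if v.1 = 0 then 0 else X ((v.1 - 1, v.2 + k) ::ₘ L.erase v)).sum⟩

theorem lam_apply (k : ℕ) (X : Hurwitz (ℕ × ℕ) K) (L) : lam k X L = (L.map fun v =>
    if v.1 = 0 then 0 else X ((v.1 - 1, v.2 + k) ::ₘ L.erase v)).sum := rfl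

theorem lam_cons (k : ℕ) (X : Hurwitz (ℕ × ℕ) K) (w : ℕ × ℕ) (L) :
    lam k X (w ::ₘ L) =
      (if w.1 = 0 then 0 else der (w.1 - 1, w.2 + k) X L) + lam k (der w X) L := by
  rw [lam_apply, lam_apply, Multiset.map_cons, Multiset.sum_cons, Multiset.erase_cons_head,
    der_apply]
  congr 2
  refine Multiset.map_congr rfl fun v hv => ?_
  rw [der_apply, Multiset.cons_swap w]
  congr 3
  by_cases h : w = v
  · subst h; rw [Multiset.erase_cons_head, Multiset.cons_erase hv]
  · rw [Multiset.erase_cons_tail _ h]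

theorem lam_add (k : ℕ) (f g : Hurwitz (ℕ × ℕ) K) : lam k (f + g) = lam k f + lam k g := by
  ext L
  rw [coeff_add, lam_apply, lam_apply, lam_apply, ← Multiset.sum_map_add]
  congr 1
  refine Multiset.map_congr rfl fun v _ => ?_
  split_ifs <;> simp

theorem lam_mul (k : ℕ) (f g : Hurwitz (ℕ × ℕ) K) :
    lam k (f * g) = f * lam k g + lam k f * g := by
  ext L
  induction L using Multiset.induction_on generalizing f g with
  | empty => simp [lam_apply, coeff_mul_zero]
  | cons w L ih =>
    have e : ∀ X : Hurwitz (ℕ × ℕ) K, der w (lam k X) =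
        (if w.1 = 0 then 0 else der (w.1 - 1, w.2 + k) X) + lam k (der w X) := by
      intro X; ext M
      rw [der_apply, lam_cons, coeff_add]
      split_ifs <;> rfl
    rw [lam_cons, coeff_add, mul_cons, mul_cons,
      show der w (f * g) = f * der w g + der w f * g from der_mul w f g,
      lam_add, coeff_add, ih, ih, e, e]
    split_ifs with h
    · simp only [zero_add, coeff_add]
      ring
    · simp only [der_mul, mul_add, add_mul, coeff_add]
      ring

theorem lam_const_mul (k : ℕ) (a : K) (f : Hurwitz (ℕ × ℕ) K) :
    lam k (const a * f) = const a * lam k f := by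
  ext L
  rw [const_mul_apply, lam_apply, lam_apply, ← Multiset.sum_map_mul_left]
  congr 1
  refine Multiset.map_congr rfl fun v _ => ?_
  split_ifs
  · simp
  · rw [const_mul_apply]

/-- `lam` as a linear map. -/
def lamₗ [Algebra ℚ K] (k : ℕ) : Hurwitz (ℕ × ℕ) K →ₗ[ℚ] Hurwitz (ℕ × ℕ) K where
  toFun := lam k
  map_add' := lam_add k
  map_smul' a f := by
    ext L
    rw [RingHom.id_apply, coeff_smul, lam_apply, lam_apply, Multiset.smul_sum, Multiset.map_map]
    congr 1
    refine Multiset.map_congr rfl fun v _ => ?_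
    simp only [Function.comp_apply, coeff_smul]
    split_ifs <;> simp

theorem lam_exp [Algebra ℚ K] (k : ℕ) {h : Hurwitz (ℕ × ℕ) K} (h0 : h 0 = 0) :
    lam k (exp h) = exp h * lam k h :=
  derivation_exp h0 (lamₗ k) (lam_mul k) fun f g L H => by
    change lam k f L = lam k g L
    rw [lam_apply, lam_apply]
    congr 1
    refine Multiset.map_congr rfl fun v hv => ?_
    have := Multiset.card_erase_add_one hv
    rw [H _ (by rw [Multiset.card_cons]; omega)]

end Hurwitz

namespace MinimalGW

open Finset

noncomputable section

namespace JFun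

open Op Hurwitz

variable {A : Type*} [CommRing A]

/-- The Euler vector field with weights `φ` of the variables and weights `ψ` of the monomials in
`D` and `z`. -/
def eul (φ : ℕ × ℕ → ℤ) (ψ : ℕ × ℤ →+ ℤ) (X : Hurwitz (ℕ × ℕ) (Op A)) : Hurwitz (ℕ × ℕ) (Op A) :=
  ⟨fun L => ((L.map φ).sum : Op A) * X L - wt ψ (X L)⟩

theorem eul_apply (φ : ℕ × ℕ → ℤ) (ψ : ℕ × ℤ →+ ℤ) (X : Hurwitz (ℕ × ℕ) (Op A)) (L) :
    eul φ ψ X L = ((L.map φ).sum : Op A) * X L - wt ψ (X L) := rfl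

theorem der_eul (φ : ℕ × ℕ → ℤ) (ψ : ℕ × ℤ →+ ℤ) (X : Hurwitz (ℕ × ℕ) (Op A)) (w) :
    der w (eul φ ψ X) = const (φ w : Op A) * der w X + eul φ ψ (der w X) := by
  ext1 L
  simp only [der_apply, eul_apply, coeff_add, const_mul_apply, Multiset.map_cons,
    Multiset.sum_cons]
  push_cast
  ring

theorem eul_add (φ : ℕ × ℕ → ℤ) (ψ : ℕ × ℤ →+ ℤ) (f g : Hurwitz (ℕ × ℕ) (Op A)) :
    eul φ ψ (f + g) = eul φ ψ f + eul φ ψ g := by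
  ext1 L
  simp only [eul_apply, coeff_add, map_add]
  ring

theorem eul_mul (φ : ℕ × ℕ → ℤ) (ψ : ℕ × ℤ →+ ℤ) (f g : Hurwitz (ℕ × ℕ) (Op A)) :
    eul φ ψ (f * g) = f * eul φ ψ g + eul φ ψ f * g := by
  ext1 L
  induction L using Multiset.induction_on generalizing f g with
  | empty =>
    simp only [eul_apply, coeff_mul_zero, coeff_add, wt_mul, Multiset.map_zero, Multiset.sum_zero]
    push_cast
    ring
  | cons w L ih =>
    rw [← der_apply, der_eul, coeff_add, coeff_add, mul_cons, mul_cons, der_mul, eul_add,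
      coeff_add, ih, ih, der_eul, der_eul]
    simp only [mul_add, add_mul, coeff_add, const_mul_apply, mul_left_comm f, mul_assoc]
    ring

/-- `eul` as a linear map. -/
def eulₗ [Algebra ℚ A] (φ : ℕ × ℕ → ℤ) (ψ : ℕ × ℤ →+ ℤ) :
    Hurwitz (ℕ × ℕ) (Op A) →ₗ[ℚ] Hurwitz (ℕ × ℕ) (Op A) where
  toFun := eul φ ψ
  map_add' := eul_add φ ψ
  map_smul' a f := by
    ext1 L
    rw [RingHom.id_apply, coeff_smul, eul_apply, eul_apply, coeff_smul, smul_sub,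
      mul_smul_comm, ← algebraMap_smul A a, ← algebraMap_smul A a, ← algebraMap_smul A a, map_smul]

theorem eul_exp [Algebra ℚ A] (φ : ℕ × ℕ → ℤ) (ψ : ℕ × ℤ →+ ℤ) {h : Hurwitz (ℕ × ℕ) (Op A)}
    (h0 : h 0 = 0) : eul φ ψ (Hurwitz.exp h) = Hurwitz.exp h * eul φ ψ h :=
  derivation_exp h0 (eulₗ φ ψ) (eul_mul φ ψ) fun f g L H => by
    change eul φ ψ f L = eul φ ψ g L
    rw [eul_apply, eul_apply, H L (by simp)]

theorem wt_mon_mul (ψ : ℕ × ℤ →+ ℤ) (i : ℕ) (k : ℤ) (x : Op A) :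
    wt ψ (mon i k * x) = mon i k * (wt ψ x + (ψ (i, k) : Op A) * x) := by
  rw [wt_mul, mul_add, mon, wt_single, mul_one]
  congr 1
  have : (AddMonoidAlgebra.single (i, k) (ψ (i, k) : A) : Op A) =
      ψ (i, k) • AddMonoidAlgebra.single (i, k) 1 := by
    rw [AddMonoidAlgebra.smul_single]; simp
  rw [this, zsmul_eq_mul]
  ring

theorem eul_const_mon_mul (φ : ℕ × ℕ → ℤ) (ψ : ℕ × ℤ →+ ℤ) (i : ℕ) (k : ℤ)
    (f : Hurwitz (ℕ × ℕ) (Op A)) : eul φ ψ (const (mon i k) * f) =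
      const (mon i k) * (eul φ ψ f - const (ψ (i, k) : Op A) * f) := by
  ext1 L
  simp only [eul_apply, const_mul_apply, coeff_sub, wt_mon_mul]
  ring

variable (J : JFun A)

/-- The coefficients of `H^r z^s` in the action on `J`. -/
def act (r : ℕ) (s : ℤ) (X : Hurwitz (ℕ × ℕ) (Op A)) : Hurwitz (ℕ × ℕ) A :=
  ⟨fun L => J.co r s (X L)⟩

@[simp] theorem act_apply (r : ℕ) (s : ℤ) (X : Hurwitz (ℕ × ℕ) (Op A)) (L) :
    J.act r s X L = J.co r s (X L) := rfl

theorem act_add (r : ℕ) (s : ℤ) (X Y : Hurwitz (ℕ × ℕ) (Op A)) :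
    J.act r s (X + Y) = J.act r s X + J.act r s Y := by ext L; simp

theorem act_sum {α : Type*} (t : Finset α) (r : ℕ) (s : ℤ) (X : α → Hurwitz (ℕ × ℕ) (Op A)) :
    J.act r s (∑ a ∈ t, X a) = ∑ a ∈ t, J.act r s (X a) := by
  ext L; simp [coeff_sum]

theorem der_act (v : ℕ × ℕ) (r : ℕ) (s : ℤ) (X : Hurwitz (ℕ × ℕ) (Op A)) :
    der v (J.act r s X) = J.act r s (der v X) := rfl

theorem lam_act (k : ℕ) (r : ℕ) (s : ℤ) (X : Hurwitz (ℕ × ℕ) (Op A)) :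
    lam k (J.act r s X) = J.act r s (lam k X) := by
  ext L
  rw [act_apply, lam_apply, lam_apply, map_multiset_sum, Multiset.map_map]
  congr 1
  refine Multiset.map_congr rfl fun v _ => ?_
  simp only [Function.comp_apply, act_apply]
  split_ifs <;> simp

theorem act_z_mul (r : ℕ) (s m : ℤ) (X : Hurwitz (ℕ × ℕ) (Op A)) :
    J.act r s (const (mon 0 m) * X) = J.act r (s - m) X := by
  ext L
  rw [act_apply, const_mul_apply, co_z_mul, act_apply]

/-- Hurwitz series over `A` as symbols not involving `D` and `z`. -/
def incl (φ : Hurwitz (ℕ × ℕ) A) : Hurwitz (ℕ × ℕ) (Op A) := ⟨fun L => φ L • 1⟩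

theorem der_incl (v : ℕ × ℕ) (φ : Hurwitz (ℕ × ℕ) A) : der v (incl φ) = incl (der v φ) := rfl

theorem incl_mem_poly (φ : Hurwitz (ℕ × ℕ) A) (L) : incl φ L ∈ poly A :=
  Submodule.smul_mem _ _ one_mem_poly

theorem act_incl_mul (r : ℕ) (s : ℤ) (φ : Hurwitz (ℕ × ℕ) A) (X : Hurwitz (ℕ × ℕ) (Op A)) :
    J.act r s (incl φ * X) = φ * J.act r s X := by
  ext L
  induction L using Multiset.induction_on generalizing φ X with
  | empty => simp [coeff_mul_zero, incl]
  | cons w L ih =>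
    rw [← der_apply, der_act, der_mul, act_add, coeff_add, mul_cons, der_incl, ih, ih, der_act]

theorem tgt_of_two_le_card {L : Multiset (ℕ × ℕ)} (h : 2 ≤ L.card) (r : ℕ) (s : ℤ) :
    tgt A L r s = 0 := by
  simp [tgt, show L.card ≠ 0 by omega, show L.card ≠ 1 by omega]

variable [Algebra ℚ A]

theorem const_mul_g_zero (x : Op A) : (const x * J.g : Hurwitz (ℕ × ℕ) (Op A)) 0 = 0 :=
  const_mul_zero_apply J.isSolution_g.zero x

/-- The invariants `⟨…, τ_d H_r⟩` as functions of the upper entries. -/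
def inv (d r : ℕ) : Hurwitz (ℕ × ℕ) A := J.act r (-d - 1) J.f

theorem inv_apply (d r : ℕ) (L) : J.inv d r L = J.co r (-d - 1) (J.f L) := rfl

/-- Invariants of negative degree vanish. -/
theorem inv_eq_zero {d r : ℕ} {L} (h : nw L + 2 + d - r < 0) : J.inv d r L = 0 :=
  J.co_eq_zero (J.f_mem_fil L) (by omega)

/-- The polynomial part of a combination of the coordinate vector fields `∂/∂t_{0,a}`. -/
theorem act_incl_mul_der_f (φ : Hurwitz (ℕ × ℕ) A) (a r : ℕ) (s : ℤ) (hs : 0 ≤ s) :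
    J.act r s (incl φ * der (0, a) J.f) = const (if r = a ∧ s = 0 then 1 else 0) * φ := by
  rw [act_incl_mul, mul_comm]
  congr 1
  ext L
  rw [act_apply, der_apply, J.co_f _ _ _ hs, const]
  dsimp only
  split_ifs with h
  · rw [Multiset.card_eq_zero] at h
    subst h
    simp [tgt_singleton, *]
  · rw [Multiset.card_eq_zero] at h
    subst h
    simp [tgt_singleton, *]
  · exact tgt_of_two_le_card (by rw [Multiset.card_cons]; omega) _ _

theorem z_mul_der_E (v : ℕ × ℕ) : const (mon 0 1) * der v J.E = J.E * der v J.g := by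
  rw [← der_const_mul, ← f, der_f]

/-! ### Topological recursion -/

/-- The second derivatives of the cone lie in `z⁻¹` times its tangent space. -/
theorem z_mul_der_der_f (v w : ℕ × ℕ) : const (mon 0 1) * der v (der w J.f) =
    J.E * (der v J.g * der w J.g + const (mon 0 1) * der v (der w J.g)) := by
  rw [der_f, der_mul, mul_add, ← mul_assoc _ (der v J.E), z_mul_der_E]
  ring

/-- The quantum differential equation: the second derivatives of the cone are combinations of the
first derivatives `∂/∂t_{0,a}`, since the difference is tangent to the cone and has no polynomial
part. The bound `N` keeps the sum over `a` finite. -/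
theorem z_mul_der_der_f_apply (v w : ℕ × ℕ) (L : Multiset (ℕ × ℕ)) (N : ℕ)
    (hN : ∀ M ≤ L, ∀ a, N ≤ a → J.inv 0 a (v ::ₘ w ::ₘ M) = 0) :
    (const (mon 0 1) * der v (der w J.f) : Hurwitz (ℕ × ℕ) (Op A)) L =
      (∑ a ∈ range N, incl (der v (der w (J.inv 0 a))) * der (0, a) J.f :
        Hurwitz (ℕ × ℕ) (Op A)) L := by
  rw [← sub_eq_zero, ← coeff_sub]
  set φ : ℕ → Hurwitz (ℕ × ℕ) A := fun a => der v (der w (J.inv 0 a))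
  set Y : Hurwitz (ℕ × ℕ) (Op A) := der v J.g * der w J.g + const (mon 0 1) * der v (der w J.g)
    - ∑ a ∈ range N, incl (φ a) * der (0, a) J.g with hY
  have e : const (mon 0 1) * der v (der w J.f) - ∑ a ∈ range N, incl (φ a) * der (0, a) J.f =
      J.E * Y := by
    rw [hY, mul_sub, z_mul_der_der_f, mul_sum]
    refine congrArg₂ (· - ·) rfl (sum_congr rfl fun a _ => ?_)
    rw [der_f]; ring
  rw [e]
  have hg : ∀ u M, der u J.g M ∈ poly A := fun u M => J.isSolution_g.poly _
  refine J.E_mul_eq_zero (fun M => ?_) fun M hM r s hs => ?_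
  · rw [hY, coeff_sub, coeff_add, coeff_sum, const_mul_apply]
    refine sub_mem (add_mem (mul_mem_hpoly (hg v) (hg w) M)
      (mul_mem_poly (mon_mem_poly zero_le_one) (J.isSolution_g.poly _)))
      (Submodule.sum_mem _ fun a _ => ?_)
    exact mul_mem_hpoly (incl_mem_poly _) (hg _) M
  · rw [← e, coeff_sub, map_sub, ← act_apply, ← act_apply, act_z_mul, act_sum, coeff_sum]
    simp only [J.act_incl_mul_der_f _ _ _ _ hs, const_mul_apply]
    rcases hs.lt_or_eq with hs' | rfl
    · rw [act_apply, der_apply, der_apply, J.co_f _ _ _ (by omega), tgt_of_two_le_card (by simp)]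
      simp [hs'.ne']
    · by_cases hr : r < N
      · rw [sum_eq_single r (by intro a _ ha; simp [ha.symm]) (by simp [hr])]
        simp [φ, inv_apply]
      · have h1 := hN M hM r (by omega)
        rw [inv_apply, Multiset.cons_swap] at h1
        simp only [act_apply, der_apply]
        rw [show (0 : ℤ) - 1 = -((0 : ℕ) : ℤ) - 1 by simp, h1, zero_sub, neg_eq_zero]
        refine sum_eq_zero fun a ha => ?_
        rw [if_neg, zero_mul]
        rintro ⟨rfl, -⟩
        exact hr (mem_range.1 ha)

/-- The analogue of `z_mul_der_der_f_apply` for the derivative in the direction of a descendant; the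
sign is the one of `(-z)^d` in `tgt`. -/
theorem der_psi_f_apply (v : ℕ × ℕ) (L : Multiset (ℕ × ℕ)) (N : ℕ)
    (hN : ∀ M ≤ L, ∀ a, N ≤ a → J.inv 0 a (v ::ₘ M) = 0) :
    (der (v.1 + 1, v.2) J.f + const (mon 0 1) * der v J.f : Hurwitz (ℕ × ℕ) (Op A)) L =
      (∑ a ∈ range N, incl (der v (J.inv 0 a)) * der (0, a) J.f :
        Hurwitz (ℕ × ℕ) (Op A)) L := by
  rw [← sub_eq_zero, ← coeff_sub]
  set φ : ℕ → Hurwitz (ℕ × ℕ) A := fun a => der v (J.inv 0 a)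
  set Y : Hurwitz (ℕ × ℕ) (Op A) := der (v.1 + 1, v.2) J.g + const (mon 0 1) * der v J.g
    - ∑ a ∈ range N, incl (φ a) * der (0, a) J.g with hY
  have e : der (v.1 + 1, v.2) J.f + const (mon 0 1) * der v J.f
      - ∑ a ∈ range N, incl (φ a) * der (0, a) J.f = J.E * Y := by
    rw [hY, mul_sub, mul_add, der_f, der_f, mul_sum]
    refine congrArg₂ (· - ·) (by ring) (sum_congr rfl fun a _ => ?_)
    rw [der_f]; ring
  rw [e]
  have hg : ∀ u M, der u J.g M ∈ poly A := fun u M => J.isSolution_g.poly _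
  refine J.E_mul_eq_zero (fun M => ?_) fun M hM r s hs => ?_
  · rw [hY, coeff_sub, coeff_add, coeff_sum, const_mul_apply]
    refine sub_mem (add_mem (hg _ M) (mul_mem_poly (mon_mem_poly zero_le_one) (hg v M)))
      (Submodule.sum_mem _ fun a _ => ?_)
    exact mul_mem_hpoly (incl_mem_poly _) (hg _) M
  · rw [← e, coeff_sub, coeff_add, map_sub, map_add, ← J.act_apply _ _ (_ * _), act_z_mul,
      ← J.act_apply _ _ (∑ a ∈ _, _), act_sum, coeff_sum]
    simp only [J.act_incl_mul_der_f _ _ _ _ hs, const_mul_apply, act_apply, der_apply]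
    rw [J.co_f _ _ _ hs]
    rcases hs.lt_or_eq with hs' | rfl
    · rw [J.co_f _ _ _ (by omega), sum_eq_zero (by simp [hs'.ne']), sub_zero]
      rcases Multiset.empty_or_exists_mem M with rfl | ⟨w, hw⟩
      · have h1 : s - 1 = v.1 ↔ s = (v.1 + 1 : ℕ) := by push_cast; omega
        simp only [Multiset.cons_zero, tgt_singleton, h1]
        split_ifs <;> simp [pow_succ]
      · have := Multiset.card_pos_iff_exists_mem.2 ⟨w, hw⟩
        rw [tgt_of_two_le_card (by rw [Multiset.card_cons]; omega),
          tgt_of_two_le_card (by rw [Multiset.card_cons]; omega), add_zero]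
    · have h0 : tgt A ((v.1 + 1, v.2) ::ₘ M) r 0 = 0 := by
        rcases Multiset.empty_or_exists_mem M with rfl | ⟨w, hw⟩
        · rw [Multiset.cons_zero, tgt_singleton, if_neg]
          rintro ⟨-, h⟩
          simp only at h
          omega
        · have := Multiset.card_pos_iff_exists_mem.2 ⟨w, hw⟩
          exact tgt_of_two_le_card (by rw [Multiset.card_cons]; omega) _ _
      rw [h0, zero_add]
      by_cases hr : r < N
      · rw [sum_eq_single r (by intro a _ ha; simp [ha.symm]) (by simp [hr])]
        simp [φ, inv_apply]
      · have h1 := hN M hM r (by omega)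
        rw [inv_apply] at h1
        rw [show (0 : ℤ) - 1 = -((0 : ℕ) : ℤ) - 1 by simp, h1, zero_sub, neg_eq_zero]
        refine sum_eq_zero fun a ha => ?_
        rw [if_neg, zero_mul]
        rintro ⟨rfl, -⟩
        exact hr (mem_range.1 ha)

/-- Topological recursion at the last entry. -/
theorem inv_recursionLow (v w : ℕ × ℕ) (d r : ℕ) (L : Multiset (ℕ × ℕ)) (N : ℕ)
    (hN : ∀ M ≤ L, ∀ a, N ≤ a → J.inv 0 a (v ::ₘ w ::ₘ M) = 0) :
    J.inv (d + 1) r (v ::ₘ w ::ₘ L) =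
      (∑ a ∈ range N, der v (der w (J.inv 0 a)) * der (0, a) (J.inv d r)) L := by
  have h := congrArg (J.co r (-d - 1)) (J.z_mul_der_der_f_apply v w L N hN)
  rw [← act_apply, ← act_apply, act_z_mul, act_sum] at h
  simp only [act_incl_mul] at h
  rw [inv_apply, show -((d + 1 : ℕ) : ℤ) - 1 = -d - 1 - 1 by push_cast; ring,
    Multiset.cons_swap]
  exact h

/-- Topological recursion at an upper entry. -/
theorem inv_recursionUp (v w : ℕ × ℕ) (d r : ℕ) (L : Multiset (ℕ × ℕ)) (N : ℕ)
    (hN : ∀ M ≤ w ::ₘ L, ∀ a, N ≤ a → J.inv 0 a (v ::ₘ M) = 0) :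
    J.inv d r ((v.1 + 1, v.2) ::ₘ w ::ₘ L) =
      (∑ a ∈ range N, der v (J.inv 0 a) * der (0, a) (der w (J.inv d r))) L := by
  have h := congrArg (J.co r (-d - 1)) (J.der_psi_f_apply v (w ::ₘ L) N hN)
  have h' := congrArg (J.co r (-d - 1)) (J.z_mul_der_der_f_apply v w L N
    fun M hM a ha => hN _ (Multiset.cons_le_cons w hM) a ha)
  rw [← act_apply, ← act_apply, act_sum, act_add] at h
  rw [← act_apply, ← act_apply, act_sum] at h'
  simp only [act_incl_mul, coeff_add] at h h'
  rw [coeff_sum] at h h' ⊢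
  simp only [mul_cons] at h
  rw [sum_add_distrib] at h
  simp only [der_comm w v] at h
  have e : (J.act r (-d - 1) (const (mon 0 1) * der v J.f)) (w ::ₘ L) =
      (J.act r (-d - 1) (const (mon 0 1) * der v (der w J.f))) L := by
    rw [act_z_mul, act_z_mul, act_apply, act_apply, der_apply, der_apply, der_apply,
      Multiset.cons_swap]
  rw [e, h'] at h
  have h2 := add_right_cancel h
  refine Eq.trans ?_ (h2.trans (sum_congr rfl fun a _ => ?_))
  · rfl
  rw [der_comm (0, a) w]
  rfl

/-! ### String and divisor equations -/

theorem lam_f (k : ℕ) : lam k J.f = J.E * lam k J.g := by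
  rw [f, lam_const_mul, E, expz, lam_exp _ (J.const_mul_g_zero _), lam_const_mul]
  exact J.z_mul_E_mul _

theorem lam_g_mem_poly (k : ℕ) (L) : lam k J.g L ∈ poly A := by
  rw [lam_apply]
  refine multiset_sum_mem _ fun x hx => ?_
  obtain ⟨v, -, rfl⟩ := Multiset.mem_map.1 hx
  split_ifs
  · exact zero_mem _
  · exact J.isSolution_g.poly _

theorem co_lam_f (k : ℕ) (L) (r : ℕ) (s : ℤ) (hs : 0 ≤ s) :
    J.co r s (lam k J.f L) = (L.map fun v =>
      if v.1 = 0 then 0 else tgt A ((v.1 - 1, v.2 + k) ::ₘ L.erase v) r s).sum := by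
  rw [← act_apply, ← lam_act, lam_apply]
  congr 1
  refine Multiset.map_congr rfl fun v _ => ?_
  rw [act_apply, J.co_f _ _ _ hs]

theorem co_lam_f_of_two_le_card (k : ℕ) {L : Multiset (ℕ × ℕ)} (hL : 2 ≤ L.card) (r : ℕ) (s : ℤ)
    (hs : 0 ≤ s) : J.co r s (lam k J.f L) = 0 := by
  rw [co_lam_f _ _ _ _ _ hs]
  refine Multiset.sum_eq_zero fun x hx => ?_
  obtain ⟨v, hv, rfl⟩ := Multiset.mem_map.1 hx
  have := Multiset.card_erase_add_one hv
  rw [tgt_of_two_le_card (by rw [Multiset.card_cons]; omega), ite_self]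

theorem E_eq : J.E = const (mon 0 (-1)) * J.f := by
  ext1 L; rw [const_mul_apply, ← E_apply]

/-- The string equation for the points of the cone: both sides are tangent to the cone, and their
polynomial parts agree. -/
theorem der_zero_zero_f : der (0, 0) J.f = J.E + lam 0 J.f := by
  rw [← sub_eq_zero]
  have e : der (0, 0) J.f - (J.E + lam 0 J.f) = J.E * (der (0, 0) J.g - (1 + lam 0 J.g)) := by
    rw [der_f, lam_f]; ring
  rw [e]
  ext1 L
  refine J.E_mul_eq_zero (fun M => ?_) fun M _ r s hs => ?_
  · refine sub_mem (J.isSolution_g.poly _) (add_mem ?_ (J.lam_g_mem_poly 0 M))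
    rw [coeff_one]
    split_ifs
    · exact one_mem_poly
    · exact zero_mem _
  rw [← e, E_eq, coeff_sub, coeff_add, map_sub, map_add, const_mul_apply, co_z_mul, der_apply,
    J.co_f _ _ _ hs, J.co_f _ _ _ (by omega)]
  rcases lt_or_ge M.card 2 with hM | hM
  · rw [co_lam_f _ _ _ _ _ hs]
    interval_cases h : M.card
    · rw [Multiset.card_eq_zero] at h
      subst h
      simp [tgt_singleton, tgt_zero]
    · obtain ⟨⟨d, i⟩, rfl⟩ := Multiset.card_eq_one.1 h
      rw [Multiset.map_singleton, Multiset.sum_singleton, tgt_singleton,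
        tgt_of_two_le_card (by simp)]
      simp only [Multiset.erase_singleton, Multiset.cons_zero, tgt_singleton, add_zero]
      cases d with
      | zero =>
        rw [if_neg (by push_cast; omega)]; simp
      | succ d =>
        have : s - -1 = (d + 1 : ℕ) ↔ s = d := by push_cast; omega
        simp only [this, Nat.add_sub_cancel, Nat.succ_ne_zero, if_false]
        split_ifs <;> simp [pow_succ]
  · rw [tgt_of_two_le_card (by rw [Multiset.card_cons]; omega), tgt_of_two_le_card hM,
      J.co_lam_f_of_two_le_card _ hM _ _ hs]
    simp

/-- The string equation. -/
theorem inv_string (d r : ℕ) (L) : J.inv d r ((0, 0) ::ₘ L) = lam 0 (J.inv d r) L +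
    if d = 0 then tgt A L r 0 else J.inv (d - 1) r L := by
  have h := congrArg (fun X : Hurwitz (ℕ × ℕ) (Op A) => J.co r (-d - 1) (X L)) J.der_zero_zero_f
  rw [coeff_add, map_add, ← act_apply _ _ _ (lam 0 J.f), ← lam_act, E_eq, const_mul_apply,
    co_z_mul] at h
  rw [add_comm]
  refine h.trans ?_
  congr 1
  split_ifs with hd
  · subst hd
    rw [J.co_f _ _ _ (by simp)]; simp
  · rw [inv_apply, show -(d : ℤ) - 1 - -1 = -((d - 1 : ℕ) : ℤ) - 1 by omega]

theorem nw_eq (L : Multiset (ℕ × ℕ)) :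
    nw L = (L.map fun v => (v.1 + v.2 - 1 : ℤ)).sum := rfl

/-- The Euler vector field acts on symbols of operators, with the weights given by the degree. -/
theorem z_mul_eul_E : const (mon 0 1) * eul (fun v => v.1 + v.2 - 1) degWt J.E =
    J.E * (eul (fun v => v.1 + v.2 - 1) degWt J.g + J.g) := by
  rw [E, expz, eul_exp _ _ (J.const_mul_g_zero _), eul_const_mon_mul]
  refine (J.z_mul_E_mul _).trans (congrArg (J.E * ·) ?_)
  ext1 L
  rw [coeff_sub, coeff_add, const_mul_apply]
  simp [degWt]

/-- Acting with `D` and the Euler vector field together, the multiple of the exponent of `q` that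
comes from `D` turns into the multiple `nw L + 1 - r - s`, which no longer involves the symbol. -/
theorem co_D_mul_E_add (L) (r : ℕ) (s : ℤ) :
    J.co r s ((const (mon 1 0) * J.E +
      const (mon 0 1) * eul (fun v => v.1 + v.2 - 1) degWt J.E : Hurwitz (ℕ × ℕ) (Op A)) L) =
    J.coPred r (s + 1) (J.f L) + (nw L + 1 - r - s : ℤ) * J.co r s (J.f L) := by
  have h1 : ∀ r' s', J.co r' s' (J.E L) = J.co r' (s' + 1) (J.f L) := fun r' s' => by
    rw [E_apply, co_z_mul, sub_neg_eq_add]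
  rw [coeff_add, map_add, const_mul_apply, const_mul_apply, co_D_mul, co_z_mul, eul_apply,
    map_sub, ← nw_eq, ← zsmul_eq_mul (J.E L) (nw L), map_zsmul, zsmul_eq_mul]
  simp only [coPred, h1, sub_add_cancel]
  push_cast
  ring

/-- The divisor equation for the points of the cone: both sides are tangent to the cone, and their
polynomial parts agree. The last term vanishes on the polynomial part by homogeneity. -/
theorem der_zero_one_f_apply (L) (r : ℕ) (s : ℤ) : J.co r s (J.f ((0, 1) ::ₘ L)) =
    J.co r s (lam 1 J.f L) + J.coPred r (s + 1) (J.f L) +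
      (nw L + 1 - r - s : ℤ) * J.co r s (J.f L) := by
  rw [add_assoc, ← co_D_mul_E_add, ← map_add, ← coeff_add, ← der_apply, ← sub_eq_zero, ← map_sub,
    ← coeff_sub]
  set φ : ℕ × ℕ → ℤ := fun v => v.1 + v.2 - 1
  have e : der (0, 1) J.f - (lam 1 J.f + (const (mon 1 0) * J.E + const (mon 0 1) *
      eul φ degWt J.E)) =
      J.E * (der (0, 1) J.g - (lam 1 J.g + (const (mon 1 0) + (eul φ degWt J.g + J.g)))) := by
    rw [z_mul_eul_E, der_f, lam_f]; ring
  suffices H : (J.E * (der (0, 1) J.g -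
      (lam 1 J.g + (const (mon 1 0) + (eul φ degWt J.g + J.g)))) : Hurwitz (ℕ × ℕ) (Op A)) L = 0 by
    rw [e, H, map_zero]
  have hg := J.isSolution_g.poly
  refine J.E_mul_eq_zero (fun M => ?_) fun M _ r s hs => ?_
  · refine sub_mem (hg _) (add_mem (J.lam_g_mem_poly 1 M) (add_mem ?_ (add_mem ?_ (hg M))))
    · rw [const]
      dsimp only
      split_ifs
      · exact mon_mem_poly le_rfl
      · exact zero_mem _
    · rw [eul_apply]
      refine sub_mem ?_ (wt_mem_suppIn _ (hg M))
      rw [← zsmul_eq_mul]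
      exact zsmul_mem (hg M) _
  rw [← e, coeff_sub, coeff_add, map_sub, map_add, co_D_mul_E_add, der_apply, J.co_f _ _ _ hs,
    J.co_f _ _ _ hs]
  have h0 : ((nw M + 1 - r - s : ℤ) : A) * tgt A M r s = 0 := by
    by_cases h : nw M + 1 = r + s
    · rw [show nw M + 1 - r - s = 0 by omega]; simp
    · rw [tgt_eq_zero h, mul_zero]
  rw [h0, coPred, J.co_f _ _ _ (by omega)]
  rcases lt_or_ge M.card 2 with hM | hM
  · rw [co_lam_f _ _ _ _ _ hs]
    interval_cases h : M.card
    · rw [Multiset.card_eq_zero] at h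
      subst h
      simp only [Multiset.cons_zero, tgt_singleton, tgt_zero]
      cases r <;> simp
    · obtain ⟨⟨d, i⟩, rfl⟩ := Multiset.card_eq_one.1 h
      rw [Multiset.map_singleton, Multiset.sum_singleton, tgt_singleton,
        tgt_of_two_le_card (by simp)]
      simp only [Multiset.erase_singleton, Multiset.cons_zero, tgt_singleton]
      cases r with
      | zero => simp
      | succ r =>
        cases d with
        | zero =>
          simp [show s + 1 ≠ 0 by omega]
        | succ d =>
          have : s + 1 = (d + 1 : ℕ) ↔ s = d := by push_cast; omega
          simp only [this, Nat.add_sub_cancel, Nat.succ_ne_zero, if_false, add_left_inj]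
          split_ifs <;> simp [pow_succ]
  · rw [tgt_of_two_le_card (by rw [Multiset.card_cons]; omega), tgt_of_two_le_card hM,
      J.co_lam_f_of_two_le_card _ hM _ _ hs]
    simp

/-- The divisor equation. -/
theorem inv_divisor (d r : ℕ) (L) (h : 0 < nw L + 2 + d - r) : J.inv d r ((0, 1) ::ₘ L) =
    (nw L + 2 + d - r : ℤ) * J.inv d r L + lam 1 (J.inv d r) L +
      if d = 0 ∨ r < 1 then 0 else J.inv (d - 1) (r - 1) L := by
  rw [inv_apply, der_zero_one_f_apply, ← act_apply, ← lam_act, ← inv, ← inv_apply,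
    show nw L + 1 - r - (-(d : ℤ) - 1) = nw L + 2 + d - r by ring]
  have : J.coPred r (-(d : ℤ) - 1 + 1) (J.f L) =
      if d = 0 ∨ r < 1 then 0 else J.inv (d - 1) (r - 1) L := by
    rw [coPred]
    by_cases hr : r = 0
    · simp [hr]
    by_cases hd : d = 0
    · subst hd
      rw [J.co_f _ _ _ (by simp), tgt_eq_zero (by omega)]; simp
    · rw [if_neg hr, if_neg (by omega), inv_apply,
        show -(d : ℤ) - 1 + 1 = -((d - 1 : ℕ) : ℤ) - 1 by omega]
  rw [this]
  ring

/-! ### Invariants of degree zero -/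

/-- In degree zero the invariants are linear over the polynomials in `H`. -/
theorem inv_shift_one (k i d r : ℕ) (L) (h : nw L + 1 + k + i + d = r) :
    J.inv d (r + 1) ((k, i + 1) ::ₘ L) = J.inv d r ((k, i) ::ₘ L) := by
  have e : der (k, i + 1) J.f - const (mon 1 0) * der (k, i) J.f =
      J.E * (der (k, i + 1) J.g - const (mon 1 0) * der (k, i) J.g) := by
    rw [der_f, der_f]; ring
  have hg := J.isSolution_g
  have hf1 : ∀ M, J.f ((k, i + 1) ::ₘ M) ∈ fil A (nw M + (k + i + 1)) := fun M => by
    refine fil_mono ?_ (J.f_mem_fil _); rw [nw_cons]; push_cast; omega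
  have hf2 : ∀ M, J.f ((k, i) ::ₘ M) ∈ fil A (nw M + (k + i)) := fun M => by
    refine fil_mono ?_ (J.f_mem_fil _); rw [nw_cons]; push_cast; omega
  have hf3 : ∀ M, mon 1 0 * J.f ((k, i) ::ₘ M) ∈ fil A (nw M + (k + i + 1)) := fun M => by
    refine fil_mono ?_ (mul_mem_fil (mon_mem_fil (M := 1) (by simp)) (hf2 M)); omega
  have hD : ∀ M (r : ℕ) (s : ℤ), r + s = nw M + (k + i + 1) →
      J.co r s (mon 1 0 * J.f ((k, i) ::ₘ M)) =
        if r = 0 then 0 else J.co (r - 1) s (J.f ((k, i) ::ₘ M)) := fun M r s hrs => by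
    rw [J.co_top (hf3 M) hrs, coeff_D_mul]
    split_ifs with hr
    · rfl
    · rw [J.co_top (hf2 M) (by omega)]
  have key := J.E_mul_mem_fil_pred
    (Y := der (k, i + 1) J.g - const (mon 1 0) * der (k, i) J.g) (e := k + i + 1)
    (fun M => by
      rw [coeff_sub, const_mul_apply]
      exact sub_mem (hg.poly _) (mul_mem_poly (mon_mem_poly le_rfl) (hg.poly _)))
    (fun M => by
      rw [coeff_sub, const_mul_apply]
      refine sub_mem (fil_mono ?_ (hg.fil _))
        (fil_mono ?_ (mul_mem_fil (mon_mem_fil (M := 1) (by simp)) (hg.fil _)))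
      · rw [nw_cons]; push_cast; omega
      · rw [nw_cons]; push_cast; omega)
    (fun M r s hs hrs => by
      rw [← e, coeff_sub, const_mul_apply, map_sub, der_apply, der_apply, hD M r s hrs,
        J.co_f _ _ _ hs, J.co_f _ _ _ hs]
      rcases Multiset.empty_or_exists_mem M with rfl | ⟨w, hw⟩
      · simp only [Multiset.cons_zero, tgt_singleton]
        cases r <;> simp
      · have := Multiset.card_pos_iff_exists_mem.2 ⟨w, hw⟩
        rw [tgt_of_two_le_card (by rw [Multiset.card_cons]; omega),
          tgt_of_two_le_card (by rw [Multiset.card_cons]; omega), ite_self, sub_zero]) L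
  rw [← e] at key
  have := J.co_eq_zero key (r := r + 1) (s := -d - 1) (by push_cast; omega)
  rw [coeff_sub, map_sub, const_mul_apply, der_apply, der_apply,
    hD L _ _ (by push_cast; omega), sub_eq_zero] at this
  rw [inv_apply, this]
  simp [inv_apply]

theorem inv_shift (k i d r : ℕ) (L) (h : nw L + 1 + k + d = r) :
    J.inv d (r + i) ((k, i) ::ₘ L) = J.inv d r ((k, 0) ::ₘ L) := by
  induction i with
  | zero => rfl
  | succ i ih => rw [← add_assoc, inv_shift_one _ _ _ _ _ _ (by push_cast; omega), ih]

/-- In degree zero the class of the last entry is dual to the product of the other ones. -/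
theorem inv_eq_zero_of_sum_ne (d r : ℕ) (L : Multiset (ℕ × ℕ)) (h : nw L + 2 + d - r = 0)
    (hne : (L.map Prod.snd).sum ≠ r) : J.inv d r L = 0 := by
  set φ : ℕ × ℕ → ℤ := fun v => v.2 with hφ
  have e : eul φ dWt J.f = J.E * eul φ dWt J.g := by
    have h0 : (const ((dWt (0, 1) : ℤ) : Op A) : Hurwitz (ℕ × ℕ) (Op A)) = 0 := by
      ext1 L; simp [const, dWt]
    have h0' : (const ((dWt (0, -1) : ℤ) : Op A) : Hurwitz (ℕ × ℕ) (Op A)) = 0 := by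
      ext1 L; simp [const, dWt]
    rw [f, eul_const_mon_mul, h0, zero_mul, sub_zero, E, expz, eul_exp _ _ (J.const_mul_g_zero _),
      eul_const_mon_mul, h0', zero_mul, sub_zero]
    exact J.z_mul_E_mul _
  have hφ' : ∀ M : Multiset (ℕ × ℕ), (M.map φ).sum = ((M.map Prod.snd).sum : ℕ) := fun M => by
    rw [Nat.cast_multiset_sum, Multiset.map_map]; rfl
  have hmem : ∀ {S} {x : Op A} (M : Multiset (ℕ × ℕ)), x ∈ suppIn A S →
      ((M.map φ).sum : Op A) * x - wt dWt x ∈ suppIn A S := fun M hx => by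
    refine sub_mem ?_ (wt_mem_suppIn _ hx)
    rw [← zsmul_eq_mul]
    exact zsmul_mem hx _
  have htop : ∀ M (r : ℕ) (s : ℤ), r + s = nw M + 1 → J.co r s (eul φ dWt J.f M) =
      (((M.map Prod.snd).sum : ℕ) - r) * J.co r s (J.f M) := fun M r s hrs => by
    rw [eul_apply, map_sub, ← zsmul_eq_mul, map_zsmul, J.co_top (wt_mem_suppIn _ (J.f_mem_fil M))
      hrs, coeff_wt, J.co_top (J.f_mem_fil M) hrs, zsmul_eq_mul, hφ']
    simp [dWt, sub_mul]
  have key := J.E_mul_mem_fil_pred (Y := eul φ dWt J.g) (e := 1)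
    (fun M => hmem M (J.isSolution_g.poly M)) (fun M => hmem M (J.isSolution_g.fil M))
    (fun M r s hs hrs => by
      rw [← e, htop M r s hrs, J.co_f _ _ _ hs]
      rcases lt_or_ge M.card 2 with hM | hM
      · interval_cases h : M.card
        · rw [Multiset.card_eq_zero] at h
          subst h
          rw [tgt_zero]
          split_ifs with h1 <;> simp [h1]
        · obtain ⟨v, rfl⟩ := Multiset.card_eq_one.1 h
          rw [tgt_singleton]
          split_ifs with h1 <;> simp [h1]
      · rw [tgt_of_two_le_card hM, mul_zero]) L
  rw [← e] at key
  have h1 := J.co_eq_zero key (r := r) (s := -d - 1) (by omega)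
  rw [htop L r _ (by omega), ← inv_apply] at h1
  have h2 : (((L.map Prod.snd).sum : ℚ) - r) ≠ 0 := sub_ne_zero.2 (by exact_mod_cast hne)
  have h3 : (((L.map Prod.snd).sum : ℚ) - r) • J.inv d r L = 0 := by
    rw [Algebra.smul_def, ← h1, map_sub, map_natCast, map_natCast]
  exact (smul_eq_zero_iff_right h2).1 h3

/-- The multinomial coefficient of the normalization axiom. -/
def mult (L : Multiset (ℕ × ℕ)) (d : ℕ) : ℚ :=
  ((L.map Prod.fst).sum + d).factorial / ((L.map fun p => (p.1.factorial : ℚ)).prod * d.factorial)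

theorem prod_factorial_ne_zero (L : Multiset (ℕ × ℕ)) :
    (L.map fun p => (p.1.factorial : ℚ)).prod ≠ 0 := by
  rw [Ne, Multiset.prod_eq_zero_iff, Multiset.mem_map]
  rintro ⟨p, -, hp⟩
  exact p.1.factorial_ne_zero (by exact_mod_cast hp)

theorem mult_lower {v : ℕ × ℕ} {L : Multiset (ℕ × ℕ)} (hv : v ∈ L) (hv0 : v.1 ≠ 0) (d : ℕ) :
    mult ((v.1 - 1, v.2 + 0) ::ₘ L.erase v) d =
      v.1 * (((L.map Prod.fst).sum + d - 1).factorial /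
        ((L.map fun p => (p.1.factorial : ℚ)).prod * d.factorial)) := by
  obtain ⟨M, rfl⟩ := Multiset.exists_cons_of_mem hv
  obtain ⟨k, i⟩ := v
  obtain ⟨k, rfl⟩ := Nat.exists_eq_succ_of_ne_zero hv0
  simp only [mult, Multiset.erase_cons_head, Multiset.map_cons, Multiset.sum_cons,
    Multiset.prod_cons, Nat.succ_eq_add_one, Nat.add_sub_cancel]
  have h1 := prod_factorial_ne_zero M
  have h2 : (d.factorial : ℚ) ≠ 0 := by exact_mod_cast d.factorial_ne_zero
  have h3 : (k.factorial : ℚ) ≠ 0 := by exact_mod_cast k.factorial_ne_zero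
  rw [show k + 1 + (M.map Prod.fst).sum + d - 1 = k + (M.map Prod.fst).sum + d by omega,
    Nat.factorial_succ]
  push_cast
  have h4 : (k + 1 : ℚ) ≠ 0 := by positivity
  field_simp

theorem mult_eq (L : Multiset (ℕ × ℕ)) (d : ℕ) (h : (L.map Prod.fst).sum + d ≠ 0) :
    mult L d = ((L.map fun v => if v.1 = 0 then 0 else
      mult ((v.1 - 1, v.2 + 0) ::ₘ L.erase v) d).sum) + if d = 0 then 0 else mult L (d - 1) := by
  set T := (L.map Prod.fst).sum with hT
  set q : ℚ := (T + d - 1).factorial /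
    ((L.map fun p => (p.1.factorial : ℚ)).prod * d.factorial) with hq
  have e1 : (L.map fun v => if v.1 = 0 then 0 else
      mult ((v.1 - 1, v.2 + 0) ::ₘ L.erase v) d).sum = T * q := by
    rw [hT, Nat.cast_multiset_sum, Multiset.map_map, ← Multiset.sum_map_mul_right]
    congr 1
    refine Multiset.map_congr rfl fun v hv => ?_
    split_ifs with h0
    · simp [h0]
    · rw [mult_lower hv h0]; rfl
  have e2 : (if d = 0 then 0 else mult L (d - 1)) = d * q := by
    split_ifs with h0
    · simp [h0]
    · obtain ⟨d, rfl⟩ := Nat.exists_eq_succ_of_ne_zero h0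
      have h1 := prod_factorial_ne_zero L
      have h2 : (d.factorial : ℚ) ≠ 0 := by exact_mod_cast d.factorial_ne_zero
      have h4 : (d + 1 : ℚ) ≠ 0 := by positivity
      rw [hq, mult, ← hT, Nat.succ_eq_add_one, Nat.add_sub_cancel, ← add_assoc,
        Nat.add_sub_cancel, Nat.factorial_succ]
      push_cast
      field_simp
  obtain ⟨m, hm⟩ := Nat.exists_eq_succ_of_ne_zero h
  have hm' : (T : ℚ) + d = m + 1 := by exact_mod_cast hm
  rw [e1, e2, ← add_mul, hm', hq, mult, ← hT, hm, Nat.succ_eq_add_one, Nat.add_sub_cancel,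
    Nat.factorial_succ]
  push_cast
  ring

theorem nw_eq_sub (L : Multiset (ℕ × ℕ)) :
    nw L = (L.map Prod.fst).sum + (L.map Prod.snd).sum - L.card := by
  induction L using Multiset.induction_on with
  | empty => simp
  | cons v L ih => rw [nw_cons, ih]; simp; ring

/-- In degree zero the string equation and linearity over the polynomials in `H` reduce the
invariants to `⟨H^0, H^0, H_0⟩ = 1`: if the descendant indices add up to `n - 3`, one of the upper
ones vanishes. -/
theorem inv_eq_mult (d r : ℕ) (L : Multiset (ℕ × ℕ))
    (hd : (L.map Prod.fst).sum + d + 2 = L.card) (hr : (L.map Prod.snd).sum = r) :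
    J.inv d r L = algebraMap ℚ A (mult L d) := by
  induction hn : L.card generalizing L d r with
  | zero => omega
  | succ n ih =>
    obtain ⟨v, hv, hv0⟩ : ∃ v ∈ L, v.1 = 0 := by
      by_contra! H
      have : (L.map fun _ => 1).sum ≤ (L.map Prod.fst).sum :=
        Multiset.sum_map_le_sum_map _ _ fun v hv => Nat.one_le_iff_ne_zero.2 (H v hv)
      simp at this
      omega
    obtain ⟨M, rfl⟩ := Multiset.exists_cons_of_mem hv
    obtain ⟨k, i⟩ := v
    obtain rfl : k = 0 := hv0
    simp only [Multiset.map_cons, Multiset.sum_cons, Multiset.card_cons] at hd hr hn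
    have hnw := nw_eq_sub M
    obtain ⟨r, rfl⟩ : ∃ r', r = r' + i := ⟨r - i, by omega⟩
    have hmult : mult ((0, i) ::ₘ M) d = mult M d := by simp [mult]
    rw [inv_shift _ _ _ _ _ _ (by push_cast; omega), inv_string, hmult, lam_apply]
    have hlow : ∀ v ∈ M, (if v.1 = 0 then 0 else
        J.inv d r ((v.1 - 1, v.2 + 0) ::ₘ M.erase v)) = algebraMap ℚ A (if v.1 = 0 then 0 else
        mult ((v.1 - 1, v.2 + 0) ::ₘ M.erase v) d) := by
      intro v hv
      split_ifs with h0
      · simp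
      · have h1 := Multiset.card_erase_add_one hv
        obtain ⟨N, rfl⟩ := Multiset.exists_cons_of_mem hv
        simp only [Multiset.erase_cons_head, Multiset.map_cons, Multiset.sum_cons,
          Multiset.card_cons] at *
        apply ih
        · simp only [Multiset.map_cons, Multiset.sum_cons, Multiset.card_cons]; omega
        · simp only [Multiset.map_cons, Multiset.sum_cons]; omega
        · simp only [Multiset.card_cons]; omega
    rw [Multiset.map_congr rfl hlow]
    by_cases hT : (M.map Prod.fst).sum + d = 0
    · obtain ⟨⟨k, j⟩, rfl⟩ := Multiset.card_eq_one.1 (show M.card = 1 by omega)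
      simp only [Multiset.map_singleton, Multiset.sum_singleton] at hT hr ⊢
      obtain rfl : k = 0 := by omega
      obtain rfl : d = 0 := by omega
      obtain rfl : j = r := by omega
      simp [tgt_singleton, mult]
    · rw [mult_eq M d hT, map_add, map_multiset_sum, Multiset.map_map]
      refine congrArg₂ (· + ·) rfl ?_
      split_ifs with hd0
      · rw [tgt_of_two_le_card (by omega), map_zero]
      · exact ih _ _ M (by omega) (by omega) (by omega)

end JFun

/-! ### The J-function of a given multiplication by `H` -/

section FundamentalSolution

open Op

variable {A : Type*} [CommRing A] [Algebra ℚ A]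

/-- The coefficient of `q^d H^r` in the solution `S(H^j)` of the quantum differential equation
`(H + z q ∂_q) S(H^j) = S(H^{j+1}) + ∑_{i ≤ j} a i j • q^{j-i+1} S(H^i)`. The power of `z` is
`j - d - r`, and the normalization `S(H^j) = H^j + O(z⁻¹)` forces the coefficient to vanish if
`d > 0` and `r + d ≤ j`. -/
def fundSol (a : ℕ → ℕ → A) (j d r : ℕ) : A :=
  match d with
  | 0 => if r = j then 1 else 0
  | d + 1 =>
    if r + d < j then 0
    else ((d + 1 : ℚ)⁻¹) • (fundSol a (j + 1) (d + 1) r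
      - (if hr : r = 0 then 0 else fundSol a j (d + 1) (r - 1))
      + ∑ i ∈ range (j + 1), if j ≤ d + i then a i j * fundSol a i (d - (j - i)) r else 0)
termination_by (d, r + d + 1 - j)

variable (a : ℕ → ℕ → A)

theorem fundSol_zero (j r : ℕ) : fundSol a j 0 r = if r = j then 1 else 0 := by
  rw [fundSol]

theorem fundSol_eq_zero {j d r : ℕ} (h : r + d < j) : fundSol a j (d + 1) r = 0 := by
  rw [fundSol, if_pos h]

/-- The value at the preceding `r`, which vanishes for `r = 0`. -/
def fundSolPred (j d r : ℕ) : A := if r = 0 then 0 else fundSol a j d (r - 1)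

/-- The quantum differential equation, in the range where it defines `fundSol` and where both sides
vanish. -/
theorem fundSol_succ (j d r : ℕ) : fundSol a (j + 1) d r =
    fundSolPred a j d r + d * fundSol a j d r -
      ∑ i ∈ range (j + 1),
        if j + 1 ≤ d + i then a i j * fundSol a i (d + i - (j + 1)) r else 0 := by
  cases d with
  | zero =>
    rw [sum_eq_zero, fundSol_zero, fundSolPred]
    · cases r <;> simp [fundSol_zero]
    · intro i hi
      rw [mem_range] at hi
      rw [if_neg (by omega)]
  | succ d =>
    have hsum : ∑ i ∈ range (j + 1), (if j + 1 ≤ d + 1 + i then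
        a i j * fundSol a i (d + 1 + i - (j + 1)) r else 0) =
        ∑ i ∈ range (j + 1), if j ≤ d + i then a i j * fundSol a i (d - (j - i)) r else 0 := by
      refine sum_congr rfl fun i hi => ?_
      rw [mem_range] at hi
      by_cases h : j ≤ d + i
      · rw [if_pos h, if_pos (by omega), show d + 1 + i - (j + 1) = d - (j - i) by omega]
      · rw [if_neg h, if_neg (by omega)]
    rcases lt_or_ge (r + d) j with h | h
    · rw [fundSol_eq_zero a (show r + d < j + 1 by omega), fundSol_eq_zero a h, sum_eq_zero,
        fundSolPred]
      · split_ifs with hr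
        · simp
        · rw [fundSol_eq_zero a (by omega)]; simp
      · intro i hi
        rw [mem_range] at hi
        split_ifs with hi'
        · obtain h0 | ⟨e, he⟩ : d + 1 + i - (j + 1) = 0 ∨ ∃ e, d + 1 + i - (j + 1) = e + 1 := by
            cases d + 1 + i - (j + 1) <;> simp
          · rw [h0, fundSol_zero, if_neg (by omega), mul_zero]
          · rw [he, fundSol_eq_zero a (by omega), mul_zero]
        · rfl
    · have key : ((d + 1 : ℕ) : A) * fundSol a j (d + 1) r = fundSol a (j + 1) (d + 1) r
          - fundSolPred a j (d + 1) r
          + ∑ i ∈ range (j + 1), if j ≤ d + i then a i j * fundSol a i (d - (j - i)) r else 0 := by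
        have h1 : ((d + 1 : ℕ) : A) * fundSol a j (d + 1) r =
            (d + 1 : ℚ) • fundSol a j (d + 1) r := by
          rw [Algebra.smul_def]; simp
        have h2 : (d + 1 : ℚ) ≠ 0 := by positivity
        rw [h1]
        conv_lhs => rw [fundSol, if_neg (by omega), smul_smul, mul_inv_cancel₀ h2, one_smul]
        rw [fundSolPred, dite_eq_ite]
      rw [hsum, key]
      ring

/-- The leading coefficients of the quantum differential equation. -/
theorem fundSol_lead (r d : ℕ) :
    ((d + 1 : ℕ) : A) * fundSol a (r + d) (d + 1) r = a r (r + d) := by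
  have h := fundSol_succ a (r + d) (d + 1) r
  have h0 : fundSolPred a (r + d) (d + 1) r = 0 := by
    rw [fundSolPred]
    split_ifs with hr
    · rfl
    · exact fundSol_eq_zero a (by omega)
  rw [h0, zero_add, fundSol_eq_zero a (show r + d < r + d + 1 by omega),
    sum_eq_single_of_mem r (by simp), if_pos (show r + d + 1 ≤ d + 1 + r by omega),
    show d + 1 + r - (r + d + 1) = 0 by omega, fundSol_zero, if_pos rfl, mul_one] at h
  · exact sub_eq_zero.1 h.symm
  · intro i hi hir
    split_ifs with h1
    · obtain ⟨e, he⟩ : ∃ e, d + 1 + i - (r + d + 1) = e + 1 :=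
        Nat.exists_eq_succ_of_ne_zero (by omega)
      rw [he, fundSol_eq_zero a (by omega), mul_zero]
    · rfl

/-- The J-function `S(1)`. -/
def JFun.ofMul (a : ℕ → ℕ → A) (h : a 0 0 = 0) : JFun A where
  c d r := if d < 0 then 0 else fundSol a 0 d.toNat r
  neg d r hd := if_pos hd
  zero r := by simp [fundSol_zero]
  one := by
    have := fundSol_lead a 0 0
    simpa [h] using this

variable (h : a 0 0 = 0)

/-- `S(H^j)` is obtained from the J-function by a differential operator. -/
theorem exists_co_eq_fundSol (j : ℕ) : ∃ P ∈ poly A, ∀ (r : ℕ) (t : ℤ), (JFun.ofMul a h).co r t P =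
    if (j : ℤ) - r - t < 0 then 0 else fundSol a j ((j : ℤ) - r - t).toNat r := by
  induction j using Nat.strong_induction_on with
  | _ j ih =>
    cases j with
    | zero =>
      refine ⟨1, one_mem_poly, fun r t => ?_⟩
      rw [← mon_zero, JFun.co_mon]
      simp [JFun.beta, JFun.ofMul]
    | succ j =>
      choose! P hP hP' using ih
      refine ⟨mon 1 0 * P j + mon 0 1 * ((j : ℤ) • P j - wt degWt (P j))
        - ∑ i ∈ range (j + 1), a i j • P i, ?_, fun r t => ?_⟩
      · have hj := hP j (by omega)
        refine sub_mem (add_mem (mul_mem_poly (mon_mem_poly le_rfl) hj)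
          (mul_mem_poly (mon_mem_poly zero_le_one) (sub_mem (zsmul_mem hj _)
            (wt_mem_suppIn _ hj)))) (Submodule.sum_mem _ fun i hi => Submodule.smul_mem _ _ ?_)
        exact hP i (mem_range.1 hi)
      · rw [map_sub, map_add, JFun.co_D_mul, JFun.co_z_mul, map_sub, map_zsmul, map_sum]
        simp only [map_smul]
        have e1 : ∀ i ∈ range (j + 1), a i j • (JFun.ofMul a h).co r t (P i) =
            if (i : ℤ) - r - t < 0 then 0 else
              a i j * fundSol a i ((i : ℤ) - r - t).toNat r := by
          intro i hi
          rw [hP' i (mem_range.1 hi), smul_eq_mul]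
          split_ifs <;> simp
        rw [sum_congr rfl e1, JFun.coPred, hP' j (by omega), hP' j (by omega)]
        set e : ℤ := ((j + 1 : ℕ) : ℤ) - r - t with he
        have e5 : (j : ℤ) - r - (t - 1) = e := by push_cast at he; omega
        have e4 : (if r = 0 then 0 else if (j : ℤ) - (r - 1 : ℕ) - t < 0 then 0 else
              fundSol a j ((j : ℤ) - (r - 1 : ℕ) - t).toNat (r - 1)) =
            if e < 0 then 0 else fundSolPred a j e.toNat r := by
          rw [fundSolPred]
          by_cases hr : r = 0
          · simp [hr]
          · rw [if_neg hr, if_neg hr, show (j : ℤ) - (r - 1 : ℕ) - t = e by push_cast at he; omega]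
        rw [e4, e5]
        rcases lt_or_ge e 0 with h0 | h0
        · simp only [if_pos h0]
          rw [sum_eq_zero]
          · simp
          · intro i hi
            rw [mem_range] at hi
            rw [if_pos (by push_cast at he; omega)]
        · simp only [if_neg (not_lt.2 h0)]
          obtain ⟨d, hd⟩ := Int.eq_ofNat_of_zero_le h0
          rw [hd, Int.toNat_natCast, fundSol_succ]
          have e2 : ∀ i ∈ range (j + 1), (if (i : ℤ) - r - t < 0 then 0 else
              a i j * fundSol a i ((i : ℤ) - r - t).toNat r) =
              if j + 1 ≤ d + i then a i j * fundSol a i (d + i - (j + 1)) r else 0 := by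
            intro i _
            by_cases h1 : j + 1 ≤ d + i
            · rw [if_pos h1, if_neg (by push_cast at he; omega),
                show ((i : ℤ) - r - t).toNat = d + i - (j + 1) by push_cast at he; omega]
            · rw [if_neg h1, if_pos (by push_cast at he; omega)]
          rw [sum_congr rfl e2]
          congr 1
          have e3 : (d : A) = j - (r + t - 1 : ℤ) := by
            have : (d : ℤ) = j - (r + t - 1) := by push_cast at he; omega
            rw [← Int.cast_natCast, this]; push_cast; ring
          rw [zsmul_eq_mul]
          rw [e3]
          push_cast
          ring

/-- The two-point invariants without descendants recover the multiplication by `H`. -/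
theorem inv_ofMul (i d : ℕ) :
    ((d + 1 : ℕ) : A) * (JFun.ofMul a h).inv 0 i {(0, i + d)} = a i (i + d) := by
  set J := JFun.ofMul a h
  obtain ⟨P, hP, hP'⟩ := exists_co_eq_fundSol a h (i + d)
  have hf : J.f {(0, i + d)} = P := by
    have h1 : J.f {(0, i + d)} = J.g {(0, i + d)} := by
      have := congrArg (fun X : Hurwitz (ℕ × ℕ) (Op A) => X 0) (J.der_f (0, i + d))
      simpa [Hurwitz.coeff_mul_zero, J.E_zero] using this
    rw [← sub_eq_zero]
    refine J.eq_zero_of_co (by rw [h1]; exact sub_mem (J.isSolution_g.poly _) hP) fun r s hs => ?_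
    rw [map_sub, J.co_f _ _ _ hs, hP', JFun.tgt_singleton]
    split_ifs with h2 h3 h3
    · push_cast at h3; omega
    · obtain ⟨rfl, rfl⟩ := h2
      simp [fundSol_zero]
    · simp
    · rcases Nat.eq_zero_or_pos ((((i + d : ℕ) : ℤ) - r - s).toNat) with h4 | h4
      · rw [h4, fundSol_zero, if_neg, sub_zero]
        rintro rfl
        exact h2 ⟨rfl, by push_cast at *; omega⟩
      · obtain ⟨e, he⟩ := Nat.exists_eq_succ_of_ne_zero h4.ne'
        rw [he, Nat.succ_eq_add_one, fundSol_eq_zero a (by omega), sub_zero]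
  rw [JFun.inv_apply, hf, hP', if_neg (by push_cast; omega), ← fundSol_lead a i d]
  congr 2
  push_cast; omega

end FundamentalSolution

end

end MinimalGW

namespace Hurwitz

theorem antidiagonal_map {α β : Type*} (f : α → β) (s : Multiset α) :
    (s.map f).antidiagonal = s.antidiagonal.map (Prod.map (Multiset.map f) (Multiset.map f)) := by
  induction s using Multiset.induction_on with
  | empty => simp
  | cons a s ih =>
    simp only [Multiset.map_cons, Multiset.antidiagonal_cons, ih, Multiset.map_add,
      Multiset.map_map]
    congr 1 <;> refine Multiset.map_congr rfl fun p _ => ?_ <;> simp [Prod.map]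

end Hurwitz

namespace MinimalGW

open Finset

noncomputable section

/-! ### Splittings of lists and of multisets -/

theorem coe_sub (u : List (ℕ × ℕ)) (S : Finset (Fin u.length)) :
    (sub u S : Multiset (ℕ × ℕ)) = S.val.map u.get := by
  rw [sub, ← Multiset.map_coe]
  congr 1
  have : (univ.filter fun k => k ∈ S) = S := by ext; simp
  conv_rhs => rw [← this]
  rw [Finset.filter_val]
  rfl

/-- Splittings of the positions of a list correspond to the elements of the antidiagonal of the
multiset of its entries, with multiplicities. -/
theorem sum_splittings {M : Type*} [AddCommMonoid M] (G : Multiset (ℕ × ℕ) → Multiset (ℕ × ℕ) → M)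
    (u : List (ℕ × ℕ)) :
    ∑ S : Finset (Fin u.length), G (sub u S) (sub u Sᶜ) =
      ((u : Multiset (ℕ × ℕ)).antidiagonal.map fun p => G p.1 p.2).sum := by
  have hu : (u : Multiset (ℕ × ℕ)) = (univ : Finset (Fin u.length)).val.map u.get := by
    change (u : Multiset (ℕ × ℕ)) = Multiset.map u.get (List.finRange u.length : List _)
    rw [Multiset.map_coe]
    simp
  rw [hu, ← Multiset.map_swap_antidiagonal, Hurwitz.antidiagonal_map,
    Multiset.antidiagonal_eq_map_powerset, Multiset.map_map, Multiset.map_map, Multiset.map_map]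
  have h1 : (univ : Finset (Finset (Fin u.length))) = (univ : Finset (Fin u.length)).powerset := by
    simp
  have h2 : (univ : Finset (Fin u.length)).powerset.val.map Finset.val =
      (univ : Finset (Fin u.length)).val.powerset := by
    simp [Finset.powerset, Multiset.map_pmap, Multiset.pmap_eq_map]
  rw [← h2, Multiset.map_map, ← h1]
  simp only [Finset.sum]
  congr 1
  refine Multiset.map_congr rfl fun S _ => ?_
  simp only [Function.comp_apply, Prod.map, Prod.swap, coe_sub]
  rw [← Finset.sdiff_val, Finset.compl_eq_univ_sdiff]

theorem degree_eq (u : List (ℕ × ℕ)) (l : ℕ × ℕ) :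
    (Symb.mk u l).degree = nw u + 2 + l.1 - l.2 := by
  rw [JFun.nw_eq_sub, Symb.degree]
  simp only [Multiset.map_coe, Multiset.sum_coe, Multiset.coe_card, Nat.cast_list_sum,
    List.map_map, Function.comp_def]
  ring

/-! ### The invariants of a J-function as a point of the minimal Gromov–Witten ring -/

/-- A bound for the total degree of the insertions. -/
def size (L : Multiset (ℕ × ℕ)) : ℕ := (L.map fun v => v.1 + v.2).sum

theorem size_cons (v : ℕ × ℕ) (L : Multiset (ℕ × ℕ)) : size (v ::ₘ L) = v.1 + v.2 + size L := by
  simp [size]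

theorem nw_le_size (L : Multiset (ℕ × ℕ)) : nw L ≤ size L := by
  induction L using Multiset.induction_on with
  | empty => simp
  | cons v L ih => rw [nw_cons, size_cons]; omega

theorem size_mono {L M : Multiset (ℕ × ℕ)} (h : L ≤ M) : size L ≤ size M := by
  obtain ⟨N, rfl⟩ := Multiset.le_iff_exists_add.1 h
  simp [size]

theorem inv_zero_eq_zero {A : Type*} [CommRing A] [Algebra ℚ A] (J : JFun A)
    {L M : Multiset (ℕ × ℕ)} (h : L ≤ M) {a : ℕ}
    (ha : size M + 3 ≤ a) :
    J.inv 0 a L = 0 := by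
  have h1 := nw_le_size L
  have h2 := size_mono h
  exact J.inv_eq_zero (by push_cast; omega)

open MvPolynomial in
/-- The evaluation of symbols by the invariants of a J-function. -/
def evalInv {A : Type*} [CommRing A] [Algebra ℂ A] [Algebra ℚ A] (J : JFun A) :
    MvPolynomial F ℂ →ₐ[ℂ] A :=
  aeval fun s => J.inv s.1.low.1 s.1.low.2 s.1.up

section evalInv

variable {A : Type*} [CommRing A] [Algebra ℂ A] [Algebra ℚ A] (J : JFun A)

theorem evalInv_sym (u : List (ℕ × ℕ)) (l : ℕ × ℕ) : evalInv J (sym u l) = J.inv l.1 l.2 u := by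
  rw [sym]
  split_ifs with h
  · simp [evalInv]
  · rw [map_zero, J.inv_eq_zero]
    rw [degree_eq] at h
    omega

theorem evalInv_glue (v w : List (ℕ × ℕ)) (l : ℕ × ℕ) (N : ℕ) (hN : size v + 3 ≤ N) :
    evalInv J (glue v w l) = ∑ a ∈ range N, J.inv 0 a v * J.inv l.1 l.2 ((0, a) ::ₘ w) := by
  have h1 := nw_le_size v
  rw [glue_eq_sum_range v w l N (by rw [degree_eq]; push_cast; omega), map_sum]
  refine sum_congr rfl fun a _ => ?_
  rw [map_mul, evalInv_sym, evalInv_sym]; rfl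

theorem coe_sub_le (u : List (ℕ × ℕ)) (S : Finset (Fin u.length)) :
    (sub u S : Multiset (ℕ × ℕ)) ≤ u := by
  rw [Multiset.coe_le]
  have h := (List.filter_sublist (p := fun k => decide (k ∈ S))
    (l := List.finRange u.length)).map u.get
  rw [show (List.finRange u.length).map u.get = u by simp] at h
  exact h.subperm

theorem evalInv_sum_glue (u x y : List (ℕ × ℕ)) (l : ℕ × ℕ) (N : ℕ) (hN : size (x + u) + 3 ≤ N)
    (f : ℕ → Hurwitz (ℕ × ℕ) A) (g : ℕ → Hurwitz (ℕ × ℕ) A)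
    (hf : ∀ a M, f a M = J.inv 0 a (x + M)) (hg : ∀ a M, g a M = J.inv l.1 l.2 ((0, a) ::ₘ (M + y)))
    (v w : Finset (Fin u.length) → List (ℕ × ℕ))
    (hv : ∀ S, (v S : Multiset (ℕ × ℕ)) = x + sub u S)
    (hw : ∀ S, (w S : Multiset (ℕ × ℕ)) = sub u Sᶜ + y) :
    evalInv J (∑ S : Finset (Fin u.length), glue (v S) (w S) l) =
      (∑ a ∈ range N, f a * g a) u := by
  rw [map_sum, Hurwitz.coeff_sum]
  have h1 : ∀ S : Finset (Fin u.length), evalInv J (glue (v S) (w S) l) =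
      ∑ a ∈ range N, f a (sub u S) * g a (sub u Sᶜ) := by
    intro S
    rw [evalInv_glue J _ _ _ N]
    · refine sum_congr rfl fun a _ => ?_
      rw [hv, hw, hf, hg]
    · rw [hv]
      have := size_mono (add_le_add_right (coe_sub_le u S) (x : Multiset (ℕ × ℕ)))
      omega
  simp only [h1]
  rw [sum_comm]
  refine sum_congr rfl fun a _ => ?_
  rw [sum_splittings fun L M => f a L * g a M, Hurwitz.coeff_mul]

theorem coe_set (u : List (ℕ × ℕ)) (s : Fin u.length) (x : ℕ × ℕ) :
    (u.set s x : Multiset (ℕ × ℕ)) = x ::ₘ (u : Multiset (ℕ × ℕ)).erase (u.get s) := by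
  have h1 : (u : Multiset (ℕ × ℕ)) = u.get s ::ₘ (u.eraseIdx s : Multiset (ℕ × ℕ)) :=
    Multiset.coe_eq_coe.2 (List.getElem_cons_eraseIdx_perm s.2).symm
  conv_rhs => rw [h1, Multiset.erase_cons_head]
  exact Multiset.coe_eq_coe.2 (List.set_perm_cons_eraseIdx s.2 x)

theorem evalInv_lowerUp (k : ℕ) (u : List (ℕ × ℕ)) (l : ℕ × ℕ) :
    evalInv J (lowerUp k u l) = (J.inv l.1 l.2).lam k u := by
  rw [lowerUp, map_sum, Hurwitz.lam_apply, Multiset.map_coe, Multiset.sum_coe,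
    ← Fin.sum_univ_fun_getElem]
  refine sum_congr rfl fun s _ => ?_
  rw [apply_ite (evalInv J), map_zero, evalInv_sym, coe_set]
  rfl

theorem evalInv_lowerLow (k : ℕ) (u : List (ℕ × ℕ)) (l : ℕ × ℕ) : evalInv J (lowerLow k u l) =
    if l.1 = 0 ∨ l.2 < k then 0 else J.inv (l.1 - 1) (l.2 - k) u := by
  rw [lowerLow, apply_ite (evalInv J), map_zero, evalInv_sym]

theorem evalInv_normalization (u : List (ℕ × ℕ)) (l : ℕ × ℕ) (h : (Symb.mk u l).degree = 0) :
    J.inv l.1 l.2 u = algebraMap ℂ A (normValue u l) := by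
  rw [degree_eq] at h
  have h1 := JFun.nw_eq_sub u
  rw [normValue]
  simp only [Multiset.map_coe, Multiset.sum_coe, Multiset.coe_card] at h1
  split_ifs with hd
  · rw [J.inv_eq_mult]
    · rw [show algebraMap ℚ A = (algebraMap ℂ A).comp (algebraMap ℚ ℂ) from Subsingleton.elim _ _,
        RingHom.comp_apply, JFun.mult]
      congr 1
      simp only [Multiset.map_coe, Multiset.sum_coe, Multiset.prod_coe, map_div₀, map_mul,
        map_natCast, map_list_prod, List.map_map]
      rfl
    · simp only [Multiset.map_coe, Multiset.sum_coe, Multiset.coe_card]; omega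
    · simp only [Multiset.map_coe, Multiset.sum_coe]; omega
  · rw [map_zero, J.inv_eq_zero_of_sum_ne _ _ _ h]
    simp only [Multiset.map_coe, Multiset.sum_coe]
    omega

/-- The invariants of a J-function satisfy the relations of the minimal Gromov–Witten ring. -/
theorem evalInv_relation {p q : MvPolynomial F ℂ} (h : Relation p q) :
    evalInv J p = evalInv J q := by
  cases h with
  | covariance u v l h => rw [evalInv_sym, evalInv_sym, Multiset.coe_eq_coe.2 h]
  | normalization u l h =>
    rw [evalInv_sym, evalInv_normalization J u l h, ← MvPolynomial.algebraMap_eq,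
      AlgHom.commutes]
  | string u l h =>
    rw [evalInv_sym, ← Multiset.cons_coe, J.inv_string, map_add, evalInv_lowerUp,
      evalInv_lowerLow]
    congr 1
    by_cases hl : l.1 = 0
    · rw [if_pos hl, if_pos (Or.inl hl), JFun.tgt]
      split_ifs with h1 h2 h3
      · omega
      · rfl
      · obtain ⟨v, hv⟩ := Multiset.card_eq_one.1 h3
        rw [hv, Multiset.map_singleton, Multiset.sum_singleton, if_neg]
        rintro ⟨h4, h5⟩
        refine h ⟨l.2, ?_, Prod.ext hl rfl⟩
        rw [Multiset.coe_eq_singleton] at hv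
        rw [hv, h4, show v = (0, v.2) from Prod.ext (by omega) rfl]
      · rfl
    · rw [if_neg hl, if_neg (by simp [hl])]; rfl
  | divisor u l h =>
    have h0 := h
    rw [degree_eq, ← Multiset.cons_coe, nw_cons] at h0
    push_cast at h0
    rw [evalInv_sym, ← Multiset.cons_coe, J.inv_divisor _ _ _ (by omega), map_add, map_add,
      map_mul, evalInv_lowerUp, evalInv_lowerLow, evalInv_sym, degree_eq, ← Multiset.cons_coe,
      nw_cons, ← MvPolynomial.algebraMap_eq, AlgHom.commutes, map_intCast]
    congr 4
    push_cast
    ring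
  | recursionUp u d j p l =>
    rw [evalInv_sum_glue J u [(d, j)] [p] l (size ((d, j) ::ₘ p ::ₘ u) + 3)
      (by simp [size]) (fun a => (J.inv 0 a).der (d, j))
      (fun a => ((J.inv l.1 l.2).der p).der (0, a)) (fun a M => rfl)
      (fun a M => by
        rw [Hurwitz.der_apply, Hurwitz.der_apply, Multiset.cons_swap]
        congr 2; rw [add_comm]; rfl)
      (fun S => (d, j) :: sub u S) (fun S => sub u Sᶜ ++ [p]) (fun S => rfl) (fun S => rfl)]
    rw [evalInv_sym, ← J.inv_recursionUp (d, j) p _ _ u]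
    · congr 1
      rw [← Multiset.coe_add, add_comm]; rfl
    · exact fun M hM a ha => inv_zero_eq_zero J (Multiset.cons_le_cons _ hM) ha
  | recursionLow u p q d r =>
    rw [evalInv_sum_glue J u [p, q] [] (d, r) (size (p ::ₘ q ::ₘ u) + 3)
      (by simp [size, add_assoc]) (fun a => ((J.inv 0 a).der q).der p)
      (fun a => (J.inv d r).der (0, a)) (fun a M => by
        rw [Hurwitz.der_apply, Hurwitz.der_apply, Multiset.cons_swap,
          show (([p, q] : List (ℕ × ℕ)) : Multiset (ℕ × ℕ)) + M = p ::ₘ q ::ₘ M by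
            simp [← Multiset.cons_coe]])
      (fun a M => by simp) (fun S => sub u S ++ [p, q]) (fun S => sub u Sᶜ)
      (fun S => by rw [add_comm]; rfl) (fun S => by simp)]
    rw [evalInv_sym, ← J.inv_recursionLow p q _ _ u]
    · congr 1
      rw [← Multiset.coe_add, add_comm]; rfl
    · exact fun M hM a ha => inv_zero_eq_zero J
        (Multiset.cons_le_cons _ (Multiset.cons_le_cons _ hM)) ha

theorem evalInv_eq_zero {x : MvPolynomial F ℂ} (hx : x ∈ Rel) : evalInv J x = 0 := by
  have : Rel ≤ RingHom.ker (evalInv J) := by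
    rw [Rel, Ideal.span_le]
    rintro _ ⟨p, q, h, rfl⟩
    simp [RingHom.mem_ker, evalInv_relation J h]
  exact this hx

end evalInv

/-- The matrix of the generic multiplication by `H`. -/
def genericMul (i j : ℕ) : MvPolynomial Idx ℂ :=
  if h : i ≤ j ∧ 0 < j then MvPolynomial.X ⟨(i, j), h⟩ else 0

/-- The invariants of the J-function of the generic multiplication by `H`. -/
def leftInverse : GW →ₐ[ℂ] MvPolynomial Idx ℂ :=
  Ideal.Quotient.liftₐ Rel (evalInv (JFun.ofMul genericMul (by simp [genericMul])))
    fun _ h => evalInv_eq_zero _ h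

/-- The divisor equation removes the entry `H` of `⟨H, H^j, H_i⟩`, which leaves the two-point
invariant computed by `inv_ofMul`. -/
theorem leftInverse_r (x : MvPolynomial Idx ℂ) : leftInverse (r x) = x := by
  suffices leftInverse.comp r = AlgHom.id ℂ _ from DFunLike.congr_fun this x
  refine MvPolynomial.algHom_ext fun p => ?_
  obtain ⟨⟨i, j⟩, h1 : i ≤ j, h2 : 0 < j⟩ := p
  obtain ⟨d, rfl⟩ := Nat.exists_eq_add_of_le h1
  set J := JFun.ofMul genericMul (by simp [genericMul])
  have e : leftInverse (r (MvPolynomial.X ⟨(i, i + d), h1, h2⟩)) =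
      J.inv 0 i ((0, 1) ::ₘ {(0, i + d)}) := by
    rw [r, MvPolynomial.aeval_X]
    exact (Ideal.Quotient.lift_mk _ _ _).trans (MvPolynomial.aeval_X _ _)
  rw [AlgHom.comp_apply, e, J.inv_divisor _ _ _ (by simp [nw]; omega)]
  have e2 := inv_ofMul genericMul (by simp [genericMul]) i d
  have e3 : (nw {(0, i + d)} + 2 + (0 : ℕ) - i : ℤ) = (d + 1 : ℕ) := by simp [nw]; ring
  rw [e3, Int.cast_natCast, e2]
  simp [Hurwitz.lam_apply, genericMul, h2]

theorem r_injective : Function.Injective r :=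
  Function.LeftInverse.injective leftInverse_r

/-! ### Symbols in the minimal Gromov–Witten ring -/

theorem mk_eq_of_relation {p q : MvPolynomial F ℂ} (h : Relation p q) :
    Ideal.Quotient.mk Rel p = Ideal.Quotient.mk Rel q :=
  Ideal.Quotient.eq.2 (Ideal.subset_span ⟨p, q, h, rfl⟩)

/-- The class of a symbol in the minimal Gromov–Witten ring, as a function of the multiset of its
upper entries. -/
def gw (L : Multiset (ℕ × ℕ)) (l : ℕ × ℕ) : GW :=
  Quotient.liftOn L (fun u => Ideal.Quotient.mk Rel (sym u l))
    fun u v h => mk_eq_of_relation (.covariance u v l h)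

theorem gw_coe (u : List (ℕ × ℕ)) (l : ℕ × ℕ) : gw u l = Ideal.Quotient.mk Rel (sym u l) := rfl

theorem gw_eq_zero {L : Multiset (ℕ × ℕ)} {l : ℕ × ℕ} (h : nw L + 2 + l.1 - l.2 < 0) :
    gw L l = 0 := by
  induction L using Quotient.inductionOn with
  | _ u =>
    rw [Multiset.quot_mk_to_coe, gw_coe, sym, dif_neg, map_zero]
    rw [degree_eq]
    exact not_le.2 h

theorem mk_C (a : ℂ) : Ideal.Quotient.mk Rel (MvPolynomial.C a) = algebraMap ℂ GW a := rfl

theorem gw_normalization {u : List (ℕ × ℕ)} {l : ℕ × ℕ} (h : nw u + 2 + l.1 - l.2 = 0) :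
    gw u l = algebraMap ℂ GW (normValue u l) := by
  rw [gw_coe, mk_eq_of_relation (.normalization u l (by rw [degree_eq, h]))]; rfl

/-- A symbol without descendants. -/
def Primary (L : Multiset (ℕ × ℕ)) : Prop := ∀ v ∈ L, v.1 = 0

theorem primary_cons {i : ℕ} {L : Multiset (ℕ × ℕ)} : Primary ((0, i) ::ₘ L) ↔ Primary L := by
  simp [Primary]

theorem Primary.exists_cons {v : ℕ × ℕ} {L : Multiset (ℕ × ℕ)} (h : Primary (v ::ₘ L)) :
    ∃ i, v = (0, i) := ⟨v.2, Prod.ext (h v (Multiset.mem_cons_self _ _)) rfl⟩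

theorem Primary.mono {L M : Multiset (ℕ × ℕ)} (h : Primary M) (hL : L ≤ M) : Primary L :=
  fun v hv => h v (Multiset.mem_of_le hL hv)

/-- In degree zero and without descendants only `⟨H^i, H^j, H_{i+j}⟩` is non-zero. -/
theorem gw_primary_degree_zero {L : Multiset (ℕ × ℕ)} (hL : Primary L) {r : ℕ}
    (h : nw L + 2 - r = 0) : gw L (0, r) = if L.card = 2 then 1 else 0 := by
  induction L using Quotient.inductionOn with
  | _ u =>
    rw [Multiset.quot_mk_to_coe] at *
    rw [gw_normalization (by push_cast; omega), normValue]
    have h1 : (u.map Prod.fst).sum = 0 := List.sum_eq_zero fun x hx => by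
      obtain ⟨v, hv, rfl⟩ := List.mem_map.1 hx
      exact hL v (by simpa using hv)
    have h2 : (u.map fun p => (p.1.factorial : ℂ)).prod = 1 := List.prod_eq_one fun x hx => by
      obtain ⟨v, hv, rfl⟩ := List.mem_map.1 hx
      simp [hL v (by simpa using hv)]
    rw [h1, h2, Multiset.coe_card]
    by_cases h3 : u.length = 2
    · simp [h3]
    · rw [if_neg h3, if_neg (by omega), map_zero]

theorem gw_string_primary {L : Multiset (ℕ × ℕ)} (hL : Primary L) {r : ℕ} (h : 0 < nw L + 1 - r) :
    gw ((0, 0) ::ₘ L) (0, r) = 0 := by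
  induction L using Quotient.inductionOn with
  | _ u =>
    rw [Multiset.quot_mk_to_coe] at *
    have hne : ¬ ∃ i : ℕ, u = [(0, i)] ∧ ((0, r) : ℕ × ℕ) = (0, i) := by
      rintro ⟨i, rfl, hi⟩
      obtain rfl : r = i := by simpa using hi
      simp [nw] at h
    rw [Multiset.cons_coe, gw_coe, mk_eq_of_relation (.string u (0, r) hne), lowerLow, lowerUp,
      sum_eq_zero, if_pos (Or.inl rfl), add_zero, map_zero]
    intro s _
    rw [if_pos (hL _ (by simp))]

variable {S : Subalgebra ℂ GW}

theorem gw_mem_of_degree_zero {L : Multiset (ℕ × ℕ)} {l : ℕ × ℕ} (h : nw L + 2 + l.1 - l.2 = 0) :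
    gw L l ∈ S := by
  induction L using Quotient.inductionOn with
  | _ u =>
    rw [Multiset.quot_mk_to_coe] at *
    rw [gw_normalization h]
    exact S.algebraMap_mem _

/-- The divisor equation, modulo symbols with fewer descendants. -/
theorem gw_divisor_mem {L : Multiset (ℕ × ℕ)} {l : ℕ × ℕ} (h : 0 < nw L + 2 + l.1 - l.2)
    (hup : ∀ v ∈ L, v.1 ≠ 0 → gw ((v.1 - 1, v.2 + 1) ::ₘ L.erase v) l ∈ S)
    (hlow : l.1 ≠ 0 → gw L (l.1 - 1, l.2 - 1) ∈ S) :
    gw ((0, 1) ::ₘ L) l ∈ S ↔ gw L l ∈ S := by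
  induction L using Quotient.inductionOn with
  | _ u =>
    rw [Multiset.quot_mk_to_coe] at *
    set δ : ℤ := (Symb.mk ((0, 1) :: u) l).degree with hδ
    have hδ' : 0 < δ := by
      rw [hδ, degree_eq, ← Multiset.cons_coe, nw_cons]; push_cast; omega
    have key : gw ((0, 1) ::ₘ u) l - (δ : ℂ) • gw u l ∈ S := by
      rw [Multiset.cons_coe, gw_coe, mk_eq_of_relation (.divisor u l hδ'), map_add, map_add,
        map_mul, mk_C, ← gw_coe, ← Algebra.smul_def, add_assoc, add_sub_cancel_left]
      refine add_mem ?_ ?_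
      · rw [lowerUp, map_sum]
        refine sum_mem fun s _ => ?_
        split_ifs with h0
        · rw [map_zero]; exact zero_mem _
        · rw [← gw_coe, coe_set]
          exact hup _ (by simp) h0
      · rw [lowerLow]
        split_ifs with h0
        · rw [map_zero]; exact zero_mem _
        · exact hlow fun h1 => h0 (Or.inl h1)
    constructor
    · intro h1
      have h2 := S.smul_mem (sub_mem h1 key) (δ : ℂ)⁻¹
      rwa [sub_sub_cancel, smul_smul, inv_mul_cancel₀ (by exact_mod_cast hδ'.ne'), one_smul] at h2
    · intro h1
      have h2 := add_mem key (S.smul_mem h1 (δ : ℂ))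
      rwa [sub_add_cancel] at h2

theorem gw_divisor_mem_primary {L : Multiset (ℕ × ℕ)} (hL : Primary L) {r : ℕ}
    (h : 0 < nw L + 2 - r) : gw ((0, 1) ::ₘ L) (0, r) ∈ S ↔ gw L (0, r) ∈ S :=
  gw_divisor_mem (by push_cast; omega) (fun v hv h0 => absurd (hL v hv) h0) fun h0 => absurd rfl h0

theorem coe_sub_add (u : List (ℕ × ℕ)) (S : Finset (Fin u.length)) :
    (sub u S + sub u Sᶜ : Multiset (ℕ × ℕ)) = u := by
  rw [coe_sub, coe_sub, ← Multiset.map_add]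
  have h : S.val + Sᶜ.val = (univ : Finset (Fin u.length)).val := by
    rw [← Finset.union_compl S, ← Finset.disjUnion_eq_union S Sᶜ disjoint_compl_right]; rfl
  rw [h]
  change Multiset.map u.get (List.finRange u.length : List _) = u
  rw [Multiset.map_coe]
  simp

theorem mk_glue_mem {v w : List (ℕ × ℕ)} {l : ℕ × ℕ}
    (h : ∀ a, gw v (0, a) * gw ((0, a) ::ₘ w) l ∈ S) : Ideal.Quotient.mk Rel (glue v w l) ∈ S := by
  rw [glue, map_sum]
  refine sum_mem fun a _ => ?_
  rw [map_mul]
  exact h a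

/-- Topological recursion at an upper entry, for membership in a subalgebra. -/
theorem gw_recursionUp_mem {d j : ℕ} {p l : ℕ × ℕ} {L : Multiset (ℕ × ℕ)}
    (h : ∀ L₁ L₂, L₁ + L₂ = L → ∀ a,
      gw ((d, j) ::ₘ L₁) (0, a) ∈ S ∧ gw ((0, a) ::ₘ p ::ₘ L₂) l ∈ S) :
    gw ((d + 1, j) ::ₘ p ::ₘ L) l ∈ S := by
  induction L using Quotient.inductionOn with
  | _ u =>
    rw [Multiset.quot_mk_to_coe] at *
    have e : ((d + 1, j) ::ₘ p ::ₘ u : Multiset (ℕ × ℕ)) = (u ++ [(d + 1, j), p] : List _) := by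
      rw [← Multiset.coe_add, add_comm (u : Multiset (ℕ × ℕ))]; rfl
    rw [e, gw_coe, mk_eq_of_relation (.recursionUp u d j p l), map_sum]
    refine sum_mem fun T _ => mk_glue_mem fun a => ?_
    have h1 := h _ _ (coe_sub_add u T) a
    refine mul_mem h1.1 ?_
    rw [← Multiset.coe_add, add_comm]
    exact h1.2

/-- Topological recursion at the last entry, for membership in a subalgebra. -/
theorem gw_recursionLow_mem {d r : ℕ} {p q : ℕ × ℕ} {L : Multiset (ℕ × ℕ)}
    (h : ∀ L₁ L₂, L₁ + L₂ = L → ∀ a,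
      gw (p ::ₘ q ::ₘ L₁) (0, a) ∈ S ∧ gw ((0, a) ::ₘ L₂) (d, r) ∈ S) :
    gw (p ::ₘ q ::ₘ L) (d + 1, r) ∈ S := by
  induction L using Quotient.inductionOn with
  | _ u =>
    rw [Multiset.quot_mk_to_coe] at *
    have e : (p ::ₘ q ::ₘ u : Multiset (ℕ × ℕ)) = (u ++ [p, q] : List _) := by
      rw [← Multiset.coe_add, add_comm]; rfl
    rw [e, gw_coe, mk_eq_of_relation (.recursionLow u p q d r), map_sum]
    refine sum_mem fun T _ => mk_glue_mem fun a => ?_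
    have h1 := h _ _ (coe_sub_add u T) a
    refine mul_mem ?_ h1.2
    rw [← Multiset.coe_add, add_comm]
    exact h1.1

/-! ### Associativity -/

/-- `∑_a ⟨V, H_a⟩ ⟨H^a, W, H_r⟩`. -/
def gwGlue (V W : Multiset (ℕ × ℕ)) (r : ℕ) : GW :=
  ∑ a ∈ range ((nw V + 2).toNat + 1), gw V (0, a) * gw ((0, a) ::ₘ W) (0, r)

/-- One side of the associativity equations. -/
def assocSum (x y w : ℕ × ℕ) (R : Multiset (ℕ × ℕ)) (r : ℕ) : GW :=
  (R.antidiagonal.map fun p => gwGlue (x ::ₘ y ::ₘ p.1) (w ::ₘ p.2) r).sum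

/-- Topological recursion at `τ_1 H_r`. -/
theorem gw_recursionLow (x y : ℕ × ℕ) (R : Multiset (ℕ × ℕ)) (r : ℕ) :
    gw (x ::ₘ y ::ₘ R) (1, r) =
      (R.antidiagonal.map fun p => gwGlue (x ::ₘ y ::ₘ p.1) p.2 r).sum := by
  induction R using Quotient.inductionOn with
  | _ u =>
    rw [Multiset.quot_mk_to_coe] at *
    have e : (x ::ₘ y ::ₘ u : Multiset (ℕ × ℕ)) = (u ++ [x, y] : List _) := by
      rw [← Multiset.coe_add, add_comm]; rfl
    rw [e, gw_coe, mk_eq_of_relation (.recursionLow u x y 0 r), map_sum,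
      ← sum_splittings fun L M => gwGlue (x ::ₘ y ::ₘ L) M r]
    refine sum_congr rfl fun T _ => ?_
    have e1 : (x ::ₘ y ::ₘ (sub u T : Multiset (ℕ × ℕ))) = (sub u T ++ [x, y] : List _) := by
      rw [← Multiset.coe_add, add_comm]; rfl
    rw [glue, map_sum, gwGlue, degree_eq, e1]
    simp only [Nat.cast_zero, add_zero, sub_zero, map_mul]
    rfl

/-- Associativity of the quantum product: the recursion for `⟨x, y, w, R, τ_1 H_r⟩` can be applied
to any two of the entries `x`, `y`, `w`, and the splittings that separate none of these entries
contribute equally. -/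
theorem assocSum_rotate (x y w : ℕ × ℕ) (R : Multiset (ℕ × ℕ)) (r : ℕ) :
    assocSum x y w R r = assocSum y w x R r := by
  have h1 := gw_recursionLow x y (w ::ₘ R) r
  have h2 := gw_recursionLow y w (x ::ₘ R) r
  have e : ∀ M : Multiset (ℕ × ℕ), y ::ₘ w ::ₘ x ::ₘ M = x ::ₘ y ::ₘ w ::ₘ M := fun M => by
    rw [Multiset.cons_swap w x, Multiset.cons_swap y x]
  rw [e, h1] at h2
  simp only [Multiset.antidiagonal_cons, Multiset.map_add, Multiset.sum_add, Multiset.map_map,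
    Function.comp_def, Prod.map, id, e] at h2
  exact add_right_cancel h2

theorem antidiagonal_sum_sub_mem (h : Multiset (ℕ × ℕ) → Multiset (ℕ × ℕ) → GW)
    {R : Multiset (ℕ × ℕ)} (hh : ∀ L M, L + M = R → L ≠ 0 → h L M ∈ S) :
    (R.antidiagonal.map fun p => h p.1 p.2).sum - h 0 R ∈ S := by
  induction R using Multiset.induction_on generalizing h with
  | empty => simp
  | cons v R ih =>
    have h1 := ih (fun L M => h L (v ::ₘ M)) fun L M hLM hL =>
      hh L (v ::ₘ M) (by rw [Multiset.add_cons, hLM]) hL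
    have h2 : (R.antidiagonal.map fun p => h (v ::ₘ p.1) p.2).sum ∈ S := by
      refine multiset_sum_mem _ fun x hx => ?_
      obtain ⟨p, hp, rfl⟩ := Multiset.mem_map.1 hx
      exact hh _ _ (by rw [Multiset.cons_add, Multiset.mem_antidiagonal.1 hp])
        Multiset.cons_ne_zero
    have h3 := add_mem h1 h2
    simp only [Multiset.antidiagonal_cons, Multiset.map_add, Multiset.sum_add, Multiset.map_map,
      Function.comp_def, Prod.map, id]
    convert h3 using 1
    ring

/-- `S` contains all invariants without descendants of degree less than `D`. -/
def Contains (S : Subalgebra ℂ GW) (D : ℤ) : Prop :=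
  ∀ L, Primary L → ∀ r : ℕ, nw L + 2 - r < D → gw L (0, r) ∈ S

/-- The terms of a glued product in which both factors have positive degree are known by induction,
those in which one factor has degree zero are multiples of the other factor. -/
theorem gwGlue_sub_mem {D : ℤ} (hD : Contains S D) {V W : Multiset (ℕ × ℕ)} (hV : Primary V)
    (hW : Primary W) {r : ℕ} (hdeg : nw V + nw W + 3 - r = D) (hV2 : 0 ≤ nw V + 2)
    (h : W.card = 1 → ∀ a : ℕ, nw V + 2 - a = D → gw V (0, a) ∈ S) :
    gwGlue V W r - (if V.card = 2 then gw ((0, (nw V + 2).toNat) ::ₘ W) (0, r) else 0) ∈ S := by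
  rw [gwGlue, sum_range_succ, gw_primary_degree_zero hV (by omega), ite_mul, one_mul, zero_mul,
    add_sub_cancel_right]
  refine sum_mem fun a ha => ?_
  rw [mem_range] at ha
  have hW' : Primary ((0, a) ::ₘ W) := primary_cons.2 hW
  have hnw : nw ((0, a) ::ₘ W) = a - 1 + nw W := by rw [nw_cons]; push_cast; ring
  rcases lt_trichotomy (nw ((0, a) ::ₘ W) + 2 - r) 0 with h1 | h1 | h1
  · rw [gw_eq_zero (L := (0, a) ::ₘ W) (by push_cast; omega), mul_zero]; exact zero_mem _
  · rw [gw_primary_degree_zero hW' h1, Multiset.card_cons]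
    split_ifs with h2
    · rw [mul_one]; exact h (by omega) a (by omega)
    · rw [mul_zero]; exact zero_mem _
  · exact mul_mem (hD _ hV _ (by omega)) (hD _ hW' _ (by omega))

/-- Modulo invariants of lower degree and those in which `w` stands alone, only the splitting with
empty first part contributes to the associativity equation, with the product `H^{x+y}` of the two
entries. -/
theorem assocSum_sub_mem {D : ℤ} (hD : Contains S D) (x y w : ℕ) {R : Multiset (ℕ × ℕ)}
    (hR : Primary R) {r : ℕ} (hdeg : nw R + x + y + w - r = D)
    (h : ∀ a : ℕ, nw R + x + y - a = D → gw ((0, x) ::ₘ (0, y) ::ₘ R) (0, a) ∈ S) :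
    assocSum (0, x) (0, y) (0, w) R r - gw ((0, x + y) ::ₘ (0, w) ::ₘ R) (0, r) ∈ S := by
  have hV : ∀ L, L ≤ R → Primary ((0, x) ::ₘ (0, y) ::ₘ L) := fun L hL =>
    primary_cons.2 (primary_cons.2 (hR.mono hL))
  have hW : ∀ L, L ≤ R → Primary ((0, w) ::ₘ L) := fun L hL => primary_cons.2 (hR.mono hL)
  have key : ∀ L M, L + M = R → gwGlue ((0, x) ::ₘ (0, y) ::ₘ L) ((0, w) ::ₘ M) r -
      (if ((0, x) ::ₘ (0, y) ::ₘ L).card = 2 then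
        gw ((0, (nw ((0, x) ::ₘ (0, y) ::ₘ L) + 2).toNat) ::ₘ (0, w) ::ₘ M) (0, r) else 0) ∈ S := by
    intro L M hLM
    have h1 : nw L + nw M = nw R := by rw [← hLM, nw_add]
    have h2 : nw ((0, x) ::ₘ (0, y) ::ₘ L) = x + y - 2 + nw L := by
      rw [nw_cons, nw_cons]; push_cast; ring
    have h3 : nw ((0, w) ::ₘ M) = w - 1 + nw M := by rw [nw_cons]; push_cast; ring
    have hL : L ≤ R := hLM ▸ Multiset.le_add_right L M
    have hM : M ≤ R := hLM ▸ Multiset.le_add_left M L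
    by_cases hneg : 0 ≤ nw ((0, x) ::ₘ (0, y) ::ₘ L) + 2
    · refine gwGlue_sub_mem hD (hV L hL) (hW M hM) (by omega) hneg fun hc a ha => ?_
      obtain rfl : M = 0 := by simpa using hc
      obtain rfl : L = R := by simpa using hLM
      exact h a (by omega)
    · have h4 : ((0, x) ::ₘ (0, y) ::ₘ L).card ≠ 2 := fun hc => by
        obtain rfl : L = 0 := by simpa using hc
        rw [nw_zero] at h2
        omega
      rw [if_neg h4, sub_zero, gwGlue]
      refine sum_mem fun a _ => ?_
      rw [gw_eq_zero (by push_cast; omega), zero_mul]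
      exact zero_mem _
  have h1 := key 0 R (zero_add R)
  have h2 := antidiagonal_sum_sub_mem (S := S)
    (fun L M => gwGlue ((0, x) ::ₘ (0, y) ::ₘ L) ((0, w) ::ₘ M) r) (R := R) fun L M hLM hL => by
      have h3 := key L M hLM
      rwa [if_neg, sub_zero] at h3
      simpa using hL
  have h3 := add_mem h2 h1
  rw [sub_add_sub_cancel] at h3
  have h4 : (nw ((0, x) ::ₘ (0, y) ::ₘ 0) + 2).toNat = x + y := by
    rw [nw_cons, nw_cons, nw_zero]; push_cast; omega
  rw [h4, if_pos (by simp)] at h3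
  exact h3

/-- The range of the reconstruction map contains the invariants without descendants: by the divisor
equation and associativity, `⟨H^i, H^j, R, H_r⟩` is expressed by invariants of smaller degree or
with fewer entries, and by `⟨H^{i-1}, H^j, R, H_a⟩`. -/
theorem contains_of_prime (hS : ∀ i j : ℕ, i ≤ j → 0 < j → gw {(0, 1), (0, j)} (0, i) ∈ S)
    (D : ℤ) : Contains S D := by
  suffices h : ∀ n : ℕ, Contains S n from fun L hL r hr => h D.toNat L hL r (by omega)
  intro n
  induction n with
  | zero =>
    intro L _ r hr
    rw [gw_eq_zero (by push_cast at *; omega)]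
    exact zero_mem _
  | succ n hD =>
    have hdiv : ∀ {L : Multiset (ℕ × ℕ)}, Primary L → ∀ {r : ℕ}, nw L + 2 - r = n →
        (gw ((0, 1) ::ₘ L) (0, r) ∈ S ↔ gw L (0, r) ∈ S) := by
      intro L hL r hr
      rcases n.eq_zero_or_pos with rfl | hn
      · refine iff_of_true (gw_mem_of_degree_zero ?_) (gw_mem_of_degree_zero ?_)
        · rw [nw_cons]; push_cast at *; omega
        · push_cast at *; omega
      · exact gw_divisor_mem_primary hL (by omega)
    suffices h : ∀ c : ℕ, ∀ L : Multiset (ℕ × ℕ), L.card = c → Primary L → ∀ r : ℕ,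
        nw L + 2 - r = n → gw L (0, r) ∈ S by
      intro L hL r hr
      rcases (show nw L + 2 - r ≤ n by push_cast at hr; omega).lt_or_eq with h1 | h1
      · exact hD L hL r h1
      · exact h _ L rfl hL r h1
    rcases n.eq_zero_or_pos with rfl | hn
    · exact fun _ L _ _ r hr => gw_mem_of_degree_zero (by push_cast at *; omega)
    have hone : ∀ i r : ℕ, nw {((0 : ℕ), i)} + 2 - r = n → gw {(0, i)} (0, r) ∈ S := by
      intro i r hr
      have h1 : nw {((0 : ℕ), i)} = i - 1 := by
        rw [← Multiset.cons_zero, nw_cons, nw_zero]; push_cast; ring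
      rw [← hdiv (by simp [Primary]) hr]
      rcases i.eq_zero_or_pos with rfl | hi
      · have h2 : nw {((0 : ℕ), 1)} = 0 := by
          rw [← Multiset.cons_zero, nw_cons, nw_zero]; norm_num
        rw [← Multiset.cons_zero, Multiset.cons_swap, Multiset.cons_zero,
          gw_string_primary (by simp [Primary]) (by rw [h2]; push_cast at *; omega)]
        exact zero_mem _
      · exact hS r i (by omega) hi
    intro c
    induction c using Nat.strong_induction_on with
    | _ c ihc =>
    match c, ihc with
    | 0, _ =>
      intro L hL _ r hr
      obtain rfl := Multiset.card_eq_zero.1 hL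
      rw [← hdiv (by simp [Primary]) hr]
      refine hone 1 r ?_
      rw [← hr, ← Multiset.cons_zero, nw_cons]; push_cast; ring
    | 1, _ =>
      intro L hL hp r hr
      obtain ⟨v, rfl⟩ := Multiset.card_eq_one.1 hL
      obtain ⟨i, rfl⟩ := Primary.exists_cons hp
      exact hone i r hr
    | c + 2, ihc =>
      suffices h : ∀ i : ℕ, ∀ L : Multiset (ℕ × ℕ), L.card = c + 1 → Primary L → ∀ r : ℕ,
          nw L + i + 1 - r = n → gw ((0, i) ::ₘ L) (0, r) ∈ S by
        intro L hL hp r hr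
        obtain ⟨v, L, rfl⟩ := Multiset.card_pos_iff_exists_mem.1 (show 0 < L.card by omega) |>.imp
          fun v hv => Multiset.exists_cons_of_mem hv
        obtain ⟨i, rfl⟩ := hp.exists_cons
        rw [nw_cons] at hr
        exact h i L (by simpa using hL) (primary_cons.1 hp) r (by push_cast at *; omega)
      have hH : ∀ L : Multiset (ℕ × ℕ), L.card = c + 1 → Primary L → ∀ r : ℕ,
          nw L + 2 - r = n → gw ((0, 1) ::ₘ L) (0, r) ∈ S := fun L hL hp r hr =>
        (hdiv hp hr).2 (ihc (c + 1) (by omega) L hL hp r hr)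
      -- The entry `H^{i+1}` is split into `H` and `H^i` by associativity.
      intro i
      induction i with
      | zero =>
        intro L hL hp r hr
        rw [gw_string_primary hp (by push_cast at *; omega)]
        exact zero_mem _
      | succ i ihi =>
        intro L hL hp r hr
        rcases i.eq_zero_or_pos with rfl | hi
        · exact hH L hL hp r (by push_cast at *; omega)
        obtain ⟨v, hv⟩ := Multiset.card_pos_iff_exists_mem.1 (show 0 < L.card by omega)
        obtain ⟨R, rfl⟩ := Multiset.exists_cons_of_mem hv
        obtain ⟨j, rfl⟩ := hp.exists_cons
        have hR := primary_cons.1 hp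
        have hRc : R.card = c := by simpa using hL
        rw [nw_cons] at hr
        have h1 := assocSum_sub_mem hD 1 i j hR (r := r) (by push_cast at *; omega) fun a ha =>
          hH _ (by simp [hRc]) (primary_cons.2 hR) a (by rw [nw_cons]; push_cast at *; omega)
        have h2 := assocSum_sub_mem hD i j 1 hR (r := r) (by push_cast at *; omega) fun a ha =>
          ihi _ (by simp [hRc]) (primary_cons.2 hR) a (by rw [nw_cons]; push_cast at *; omega)
        have h3 : gw ((0, i + j) ::ₘ (0, 1) ::ₘ R) (0, r) ∈ S := by
          rw [Multiset.cons_swap]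
          exact hH _ (by simp [hRc]) (primary_cons.2 hR) r (by rw [nw_cons]; push_cast at *; omega)
        rw [← assocSum_rotate] at h2
        have h4 := sub_mem (add_mem h2 h3) h1
        rw [sub_add_cancel, sub_sub_cancel, add_comm 1 i] at h4
        exact h4

/-! ### Removal of descendants -/

/-- A subalgebra containing all invariants without descendants contains all invariants. -/
theorem gw_mem_of_contains (hS : ∀ D, Contains S D) (L : Multiset (ℕ × ℕ)) (l : ℕ × ℕ) :
    gw L l ∈ S := by
  suffices h : ∀ n : ℕ, ∀ L : Multiset (ℕ × ℕ), ∀ l : ℕ × ℕ, (L.map Prod.fst).sum + l.1 = n →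
      gw L l ∈ S from h _ L l rfl
  intro n
  induction n using Nat.strong_induction_on with
  | _ n ih =>
  have hprim : n = 0 → ∀ L : Multiset (ℕ × ℕ), ∀ l : ℕ × ℕ, (L.map Prod.fst).sum + l.1 = n →
      gw L l ∈ S := by
    rintro rfl L ⟨d, r⟩ h
    obtain ⟨h1, rfl⟩ : (L.map Prod.fst).sum = 0 ∧ d = 0 := by simpa using h
    refine hS (nw L + 2 - r + 1) L (fun v hv => ?_) r (by omega)
    exact Multiset.sum_eq_zero_iff.1 h1 _ (Multiset.mem_map_of_mem _ hv)
  rcases n.eq_zero_or_pos with hn | hn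
  · exact hprim hn
  have htwo : ∀ L : Multiset (ℕ × ℕ), ∀ l : ℕ × ℕ, 2 ≤ L.card →
      (L.map Prod.fst).sum + l.1 = n → gw L l ∈ S := by
    rintro L ⟨d, r⟩ hL hsum
    dsimp only at hsum
    cases d with
    | succ d =>
      obtain ⟨p, hp⟩ := Multiset.card_pos_iff_exists_mem.1 (show 0 < L.card by omega)
      obtain ⟨L, rfl⟩ := Multiset.exists_cons_of_mem hp
      rw [Multiset.card_cons] at hL
      obtain ⟨q, hq⟩ := Multiset.card_pos_iff_exists_mem.1 (show 0 < L.card by omega)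
      obtain ⟨L, rfl⟩ := Multiset.exists_cons_of_mem hq
      refine gw_recursionLow_mem fun L₁ L₂ h12 a => ⟨ih _ ?_ _ _ rfl, ih _ ?_ _ _ rfl⟩ <;>
      · subst h12
        simp only [Multiset.map_cons, Multiset.map_add, Multiset.sum_cons, Multiset.sum_add] at *
        omega
    | zero =>
      obtain ⟨v, hv, hv0⟩ : ∃ v ∈ L, v.1 ≠ 0 := by
        by_contra! h
        have h1 : (L.map Prod.fst).sum = 0 := Multiset.sum_eq_zero fun x hx => by
          obtain ⟨v, hv, rfl⟩ := Multiset.mem_map.1 hx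
          exact h v hv
        omega
      obtain ⟨L, rfl⟩ := Multiset.exists_cons_of_mem hv
      rw [Multiset.card_cons] at hL
      obtain ⟨p, hp⟩ := Multiset.card_pos_iff_exists_mem.1 (show 0 < L.card by omega)
      obtain ⟨L, rfl⟩ := Multiset.exists_cons_of_mem hp
      obtain ⟨d, j⟩ := v
      obtain ⟨d, rfl⟩ := Nat.exists_eq_succ_of_ne_zero hv0
      refine gw_recursionUp_mem fun L₁ L₂ h12 a => ⟨ih _ ?_ _ _ rfl, ih _ ?_ _ _ rfl⟩ <;>
      · subst h12
        simp only [Multiset.map_cons, Multiset.map_add, Multiset.sum_cons, Multiset.sum_add] at *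
        omega
  have hdiv : ∀ L : Multiset (ℕ × ℕ), ∀ l : ℕ × ℕ, (L.map Prod.fst).sum + l.1 = n →
      gw ((0, 1) ::ₘ L) l ∈ S → gw L l ∈ S := by
    intro L l hsum h
    rcases lt_trichotomy (nw L + 2 + l.1 - l.2) 0 with h1 | h1 | h1
    · rw [gw_eq_zero h1]; exact zero_mem _
    · exact gw_mem_of_degree_zero h1
    refine (gw_divisor_mem h1 (fun v hv hv0 => ?_) fun h0 => ?_).1 h
    · refine ih _ ?_ _ _ rfl
      rw [← Multiset.cons_erase hv, Multiset.map_cons, Multiset.sum_cons] at hsum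
      rw [Multiset.map_cons, Multiset.sum_cons]
      dsimp only
      omega
    · refine ih _ ?_ _ _ rfl
      dsimp only
      omega
  intro L l hsum
  refine hdiv L l hsum ?_
  by_cases hL : L.card = 0
  · refine hdiv _ l (by simpa using hsum) (htwo _ l (by simp) (by simpa using hsum))
  · exact htwo _ l (by rw [Multiset.card_cons]; omega) (by simpa using hsum)

theorem r_surjective : Function.Surjective r := by
  have hgw : ∀ L l, gw L l ∈ r.range := gw_mem_of_contains <| contains_of_prime fun i j hij hj =>
    ⟨MvPolynomial.X ⟨(i, j), hij, hj⟩, by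
      rw [AlgHom.toRingHom_eq_coe, RingHom.coe_coe, r, MvPolynomial.aeval_X]
      change _ = gw ([(0, 1), (0, j)] : List _) (0, i)
      rw [gw_coe, sym, dif_pos (show 0 ≤ (Symb.mk _ _).degree from (prime ⟨(i, j), hij, hj⟩).2)]
      rfl⟩
  intro x
  obtain ⟨p, rfl⟩ := Ideal.Quotient.mk_surjective x
  suffices h : Ideal.Quotient.mk Rel p ∈ r.range from h
  induction p using MvPolynomial.induction_on with
  | C a => exact r.range.algebraMap_mem a
  | add p q hp hq => rw [map_add]; exact add_mem hp hq
  | mul_X p s hp =>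
    rw [map_mul]
    refine mul_mem hp ?_
    have h := hgw s.1.up s.1.low
    rwa [gw_coe, sym, dif_pos s.2] at h

end

end MinimalGW

/-- The reconstruction map is bijective: `MinimalGW.r_injective` and `MinimalGW.r_surjective`. -/
theorem theorem3p1 : Function.Bijective MinimalGW.r :=
  ⟨MinimalGW.r_injective, MinimalGW.r_surjective⟩
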